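/- **Model.** Fix $\mu>1$, $\Lambda>1$, a dispatch rate $\lambda_0$ with $1<\lambda_0\le\Lambda$ and a buffer length $d\in\mathbb{N}$. Orders are placed at a restaurant in a Poisson process of rate $1$ and are prepared one at a time, first come first served, with independent exponential preparation times of rate $\mu$. Riders arrive at the restaurant in a Poisson process of rate $\lambda_0$ (the restaurant discloses no information about prepared orders, i.e. its disclosure threshold is $M=\infty$), except that no rider is sent while $d$ riders are already waiting there. An arriving rider takes the earliest prepared order and leaves; if there is none, the rider waits, and an order that becomes ready is taken by the earliest waiting rider. With $Q_1$ the number of orders not yet prepared and $Q_2$ the number of prepared orders waiting ($Q_2=-a$ if $a$ riders are waiting), $(Q_1,Q_2)$ is a continuous-time Markov chain with transitions $(q_1,q_2)\to(q_1+1,q_2)$ at rate $1$, $(q_1,q_2)\to(q_1-1,q_2+1)$ at rate $\mu$ if $q_1>0$, and $(q_1,q_2)\to(q_1,q_2-1)$ at rate $\lambda_0$ if $q_2>-d$; it starts from the empty system. The waiting time of an order is the time from its being placed to its being fetched by a rider, and that of a rider is the time from the rider's arrival at the restaurant to fetching an order; $\mathbb{E}[T_o]$ and $\mathbb{E}[T_r]$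 denote the (almost sure) long-run averages of the waiting times of the successive orders and of the successive riders. **Theorem (dilemma between customers and riders).** The long-run averages $\mathbb{E}[T_o]$ and $\mathbb{E}[T_r]$ exist almost surely as finite constants. Let $\hat\rho=1/\Lambda$ and $T^*\in\mathbb{R}$, and suppose that $\hat\rho\ge 0.3$ and $\frac{\hat\rho^4}{1-\hat\rho}\ge T^*$. If $(\lambda_0,d)$ is feasible, that is, if $\mathbb{E}[T_o]\le\frac{1}{\mu-1}+T^*$, then $$\mathbb{E}[T_r]\ \ge\ \frac{\ln(4/3)}{4}\cdot\frac{1}{1-\hat\rho}-T^*.$$ Consequently $\max(T^*,\mathbb{E}[T_r])\ge\frac{\ln(4/3)}{8(1-\hat\rho)}>0$, so for a fixed capacity $\Lambda$ the two quantities $T^*$ and $\mathbb{E}[T_r]$ cannot both be made small. -/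

import Mathlib

open MeasureTheory ProbabilityTheory Filter Topology

noncomputable section

namespace MealDelivery

/-- The three kinds of transition of the system: a customer places an order; the restaurant
finishes preparing an order; a rider sent by the platform arrives at the restaurant. -/
inductive Event where
  | order : Event
  | prepared : Event
  | rider : Event

instance : MeasurableSpace Event := ⊤

/-- The state `(Q₁, Q₂)`: `Q₁` is the number of orders in the processing queue (including the one
in preparation); `Q₂ ≥ 0` is the number of prepared orders waiting for riders, and `Q₂ = -a`
means that `a` riders are waiting and no prepared order is. -/
abbrev State := ℕ × ℤ

/-- The effect of a transition on the state. -/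
def step (s : State) : Event → State
  | Event.order => (s.1 + 1, s.2)
  | Event.prepared => (s.1 - 1, s.2 + 1)
  | Event.rider => (s.1, s.2 - 1)

/-- The signal disclosed by a restaurant with threshold `M`: it is `0` if `Q₂ ≤ M` and `Q₂ - M` if
`Q₂ > M`. For `M = ∞` it is always `0` (no disclosure). -/
def signal (M : ℕ∞) (q₂ : ℤ) : ℕ :=
  match M with
  | none => 0
  | some m => (q₂ - (m : ℤ)).toNat

/-- Transition rates. Orders are placed at rate `1`; the single server works at rate `μ` whenever
the processing queue is non-empty; riders are dispatched at rate `lam (signal)`, except that none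
is sent while `d` riders are waiting already. -/
def rate (μ : ℝ) (lam : ℕ → ℝ) (d : ℕ) (M : ℕ∞) (s : State) : Event → ℝ
  | Event.order => 1
  | Event.prepared => if 0 < s.1 then μ else 0
  | Event.rider => if -(d : ℤ) < s.2 then lam (signal M s.2) else 0

/-- Total rate of leaving the state `s`. -/
def totalRate (μ : ℝ) (lam : ℕ → ℝ) (d : ℕ) (M : ℕ∞) (s : State) : ℝ :=
  rate μ lam d M s Event.order + rate μ lam d M s Event.prepared + rate μ lam d M s Event.rider

/-- The state after the first `n` transitions `a 0, …, a (n - 1)` of a system that is empty at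
time `0`. -/
def stateAfter (a : ℕ → Event) : ℕ → State
  | 0 => (0, 0)
  | n + 1 => step (stateAfter a n) (a n)

variable {Ω : Type*} [MeasurableSpace Ω]

/-- `(e, ξ)` drives the continuous-time Markov chain `(Q₁(t), Q₂(t))` with the above rates, started
from the empty system (jump chain and holding times):
* `e n` is the kind of the `n`-th transition, and from a state `s` the next transition is of kind
  `k` with probability `rate s k / totalRate s`, independently of the earlier history;
* given all transitions, the holding times are independent, the one in the state `s` being
  exponential of parameter `totalRate s`; it is written as `ξ n / totalRate s` with `ξ n`
  independent standard exponential clocks. -/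
structure IsDispatchSystem (μ : ℝ) (lam : ℕ → ℝ) (d : ℕ) (M : ℕ∞)
    (e : ℕ → Ω → Event) (ξ : ℕ → Ω → ℝ) (P : Measure Ω) : Prop where
  measurable_event : ∀ n, Measurable (e n)
  measurable_clock : ∀ n, Measurable (ξ n)
  event_law : ∀ (n : ℕ) (a : ℕ → Event),
    P {ω | ∀ i < n, e i ω = a i} =
      ∏ i ∈ Finset.range n, ENNReal.ofReal
        (rate μ lam d M (stateAfter a i) (a i) / totalRate μ lam d M (stateAfter a i))
  clock_law : ∀ n, P.map (ξ n) = expMeasure 1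
  clock_indep : iIndepFun ξ P
  event_clock_indep : IndepFun (fun ω n => e n ω) (fun ω n => ξ n ω) P

/-- The time at which the transition number `n` (counted from `0`) takes place. -/
def jumpTime (μ : ℝ) (lam : ℕ → ℝ) (d : ℕ) (M : ℕ∞)
    (e : ℕ → Ω → Event) (ξ : ℕ → Ω → ℝ) (n : ℕ) (ω : Ω) : ℝ :=
  ∑ i ∈ Finset.range (n + 1), ξ i ω / totalRate μ lam d M (stateAfter (fun j => e j ω) i)

/-- The time of the `k`-th transition of kind `x` (counted from `0`). For `x = order` this is the
time at which order `k` is placed; for `x = prepared` the time at which order `k` is ready, as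
orders are prepared one by one in their order of arrival; for `x = rider` the time at which
rider `k` arrives at the restaurant. -/
def eventTime (μ : ℝ) (lam : ℕ → ℝ) (d : ℕ) (M : ℕ∞)
    (e : ℕ → Ω → Event) (ξ : ℕ → Ω → ℝ) (x : Event) (k : ℕ) (ω : Ω) : ℝ :=
  jumpTime μ lam d M e ξ (Nat.nth (fun n => e n ω = x) k) ω

/-- The time at which order `k` is fetched. An arriving rider takes the earliest prepared order,
and an order that becomes ready is taken by the earliest waiting rider, so order `k` is taken by
rider `k`, as soon as both the order is ready and the rider is there. -/
def fetchTime (μ : ℝ) (lam : ℕ → ℝ) (d : ℕ) (M : ℕ∞)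
    (e : ℕ → Ω → Event) (ξ : ℕ → Ω → ℝ) (k : ℕ) (ω : Ω) : ℝ :=
  max (eventTime μ lam d M e ξ Event.prepared k ω) (eventTime μ lam d M e ξ Event.rider k ω)

/-- Waiting time of order `k`: from being placed to being fetched. -/
def orderWait (μ : ℝ) (lam : ℕ → ℝ) (d : ℕ) (M : ℕ∞)
    (e : ℕ → Ω → Event) (ξ : ℕ → Ω → ℝ) (k : ℕ) (ω : Ω) : ℝ :=
  fetchTime μ lam d M e ξ k ω - eventTime μ lam d M e ξ Event.order k ω

/-- Waiting time of rider `k`: from the arrival at the restaurant to fetching an order. -/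
def riderWait (μ : ℝ) (lam : ℕ → ℝ) (d : ℕ) (M : ℕ∞)
    (e : ℕ → Ω → Event) (ξ : ℕ → Ω → ℝ) (k : ℕ) (ω : Ω) : ℝ :=
  fetchTime μ lam d M e ξ k ω - eventTime μ lam d M e ξ Event.rider k ω

/-- `w` is the mean of the waiting times `W 0, W 1, …`: almost surely their long-run average. -/
def IsMeanWait (W : ℕ → Ω → ℝ) (P : Measure Ω) (w : ℝ) : Prop :=
  ∀ᵐ ω ∂P, Tendsto (fun n : ℕ => (∑ k ∈ Finset.range n, W k ω) / n) atTop (𝓝 w)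

end MealDelivery

end

noncomputable section

namespace MealDelivery

/-! ### The law of the jump chain and a strong law for martingale differences. -/

section

/-! Put `R = Q₂ + d`. Then `(Q₁, R)` is a tandem of two exponential queues with arrival rate `1` and
service rates `μ` and `λ₀`, started from `(0, d)`. Its stationary law is a product of geometric laws
with ratios `1/μ` and `x = 1/λ₀` (`tsum_geomProd_mul_tandemGen`). In state `(a, r)` there are `a +
(r - d)⁺` orders present and `(d - r)⁺` riders waiting, and in the stationary regime every kind of
transition has rate one. Little's law therefore identifies the mean waits with stationary means:
`1/(μ - 1) + x^(d+1)/(1 - x)` for orders and `d - x/(1 - x) + x^(d+1)/(1 - x)` for riders.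

Feasibility now says `x^(d+1)/(1 - x) ≤ T*`. Since `T* ≤ ρ^4/(1 - ρ) ≤ x^4/(1 - x)`, this forces `d
≥ 3`. Adding `T*` to the riders' wait gives at least `(d(1 - x) - x + 2x^(d+1))/(1 - x)`, whose
numerator is at least `1/12` by Bernoulli's inequality (`one_twelfth_le_wait`), and `ln(4/3)/4 ≤
1/12`.

The almost sure limits rest on an ergodic theorem for the jump chain. Martingale differences average
to zero along the squares (`tendsto_avg_martingale`), so path averages asymptotically annihilate the
generator. An exponential Lyapunov function (`exists_drift`) makes these averages tight, so they
have limits along ultrafilters (`exists_ultrafilter_limit`). Each limit is an invariant weight, and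
invariant weights are unique up to a factor (`eq_zero_of_invariant`). The exponential clocks are
replaced by their means (`tendsto_avg_clock`), monotonicity passes from squares to all indices, and
a pathwise Little's law (`tendsto_avg_wait`) turns averages over transitions into averages over
customers. -/

instance : DecidableEq Event := Classical.decEq Event

instance : Fintype Event where
  elems := {Event.order, Event.prepared, Event.rider}
  complete x := by cases x <;> simp

theorem sum_event {M : Type*} [AddCommMonoid M] (f : Event → M) :
    ∑ k, f k = f Event.order + (f Event.prepared + f Event.rider) := by
  change ∑ k ∈ ({Event.order, Event.prepared, Event.rider} : Finset Event), f k = _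
  rw [Finset.sum_insert (by simp), Finset.sum_insert (by simp), Finset.sum_singleton]

instance : MeasurableSingletonClass Event := ⟨fun _ => trivial⟩

variable {Ω : Type*} [MeasurableSpace Ω] {S : Type*}

/-- The state after `n` transitions `a 0, …, a (n - 1)` from `s₀`. -/
def chainPath (nxt : S → Event → S) (s₀ : S) (a : ℕ → Event) : ℕ → S
  | 0 => s₀
  | n + 1 => nxt (chainPath nxt s₀ a n) (a n)

theorem chainPath_congr (nxt : S → Event → S) (s₀ : S) {a b : ℕ → Event} {n : ℕ}
    (h : ∀ i < n, a i = b i) : chainPath nxt s₀ a n = chainPath nxt s₀ b n := by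
  induction n with
  | zero => rfl
  | succ n ih =>
    simp only [chainPath]
    rw [ih fun i hi => h i (by omega), h n (by omega)]

/-- `e` is the sequence of transition kinds of a Markov chain with transition probabilities `p`. -/
structure HasChainLaw (p : S → Event → ℝ) (nxt : S → Event → S) (s₀ : S) (e : ℕ → Ω → Event)
    (P : Measure Ω) : Prop where
  measurable_event : ∀ n, Measurable (e n)
  event_law : ∀ (n : ℕ) (a : ℕ → Event), P {ω | ∀ i < n, e i ω = a i} =
    ∏ i ∈ Finset.range n, ENNReal.ofReal (p (chainPath nxt s₀ a i) (a i))

/-- `g` is a function of the first `n` transitions. -/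
def DependsOnFirst (n : ℕ) (g : (ℕ → Event) → ℝ) : Prop :=
  ∀ a b : ℕ → Event, (∀ i < n, a i = b i) → g a = g b

theorem DependsOnFirst.mono {n m : ℕ} {g : (ℕ → Event) → ℝ} (hg : DependsOnFirst n g)
    (h : n ≤ m) : DependsOnFirst m g := fun a b hab => hg a b fun i hi => hab i (by omega)

theorem DependsOnFirst.mul {n : ℕ} {f g : (ℕ → Event) → ℝ} (hf : DependsOnFirst n f)
    (hg : DependsOnFirst n g) : DependsOnFirst n (fun a => f a * g a) :=
  fun a b hab => by simp only [hf a b hab, hg a b hab]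

theorem dependsOnFirst_state (nxt : S → Event → S) (s₀ : S) (f : S → ℝ) (n : ℕ) :
    DependsOnFirst n (fun a => f (chainPath nxt s₀ a n)) :=
  fun a b hab => by simp only [chainPath_congr nxt s₀ hab]

theorem dependsOnFirst_step (nxt : S → Event → S) (s₀ : S) (h : S → Event → ℝ) (n : ℕ) :
    DependsOnFirst (n + 1) (fun a => h (chainPath nxt s₀ a n) (a n)) :=
  fun a b hab => by
    simp only [chainPath_congr nxt s₀ (fun i hi => hab i (Nat.lt_succ_of_lt hi)),
      hab n (Nat.lt_succ_self n)]

/-- Extension of a finite sequence of transitions. -/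
def padEvents {n : ℕ} (w : Fin n → Event) (i : ℕ) : Event :=
  if h : i < n then w ⟨i, h⟩ else Event.order

theorem DependsOnFirst.eq_pad {n : ℕ} {g : (ℕ → Event) → ℝ} (hg : DependsOnFirst n g)
    (a : ℕ → Event) : g a = g (padEvents fun i : Fin n => a i) :=
  hg _ _ fun i hi => by simp [padEvents, hi]

theorem measurable_history {e : ℕ → Ω → Event} (he : ∀ n, Measurable (e n)) (n : ℕ) :
    Measurable fun ω => (fun i : Fin n => e i ω) :=
  measurable_pi_lambda _ fun i => he i

theorem DependsOnFirst.measurable {n : ℕ} {g : (ℕ → Event) → ℝ} (hg : DependsOnFirst n g) :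
    Measurable g := by
  have h : g = (fun w : Fin n → Event => g (padEvents w)) ∘ fun a i => a i := by
    funext a; exact hg.eq_pad a
  rw [h]
  exact (measurable_of_countable _).comp (measurable_pi_lambda _ fun i => measurable_pi_apply _)

theorem DependsOnFirst.integrable {P : Measure Ω} [IsFiniteMeasure P] {e : ℕ → Ω → Event}
    (he : ∀ n, Measurable (e n)) {n : ℕ} {g : (ℕ → Event) → ℝ} (hg : DependsOnFirst n g) :
    Integrable (fun ω => g fun i => e i ω) P := by
  have h : (fun ω => g fun i => e i ω)
      = (fun w : Fin n → Event => g (padEvents w)) ∘ fun ω i => e i ω := by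
    funext ω; exact hg.eq_pad _
  rw [h]
  exact (Integrable.of_finite (f := fun w : Fin n → Event => g (padEvents w))).comp_measurable
    (measurable_history he n)

namespace HasChainLaw

variable {p : S → Event → ℝ} {nxt : S → Event → S} {s₀ : S} {e : ℕ → Ω → Event}
  {P : Measure Ω}

theorem measure_cylinder_inter (hL : HasChainLaw p nxt s₀ e P) (hp : ∀ s k, 0 ≤ p s k) {n : ℕ}
    (w : Fin n → Event) (k : Event) :
    P.real ({ω | (fun i : Fin n => e i ω) = w} ∩ {ω | e n ω = k})
      = P.real {ω | (fun i : Fin n => e i ω) = w}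
        * p (chainPath nxt s₀ (padEvents w) n) k := by
  have h1 : {ω | (fun i : Fin n => e i ω) = w} = {ω | ∀ i < n, e i ω = padEvents w i} := by
    ext ω
    simp only [Set.mem_ofPred_eq, funext_iff]
    constructor
    · intro h i hi
      simp only [padEvents, hi, dif_pos]
      exact h ⟨i, hi⟩
    · intro h i
      have := h i i.2
      simpa [padEvents] using this
  have hlt : ∀ i < n, Function.update (padEvents w) n k i = padEvents w i := fun i hi =>
    Function.update_of_ne (by omega) _ _
  have h2 : {ω | (fun i : Fin n => e i ω) = w} ∩ {ω | e n ω = k}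
      = {ω | ∀ i < n + 1, e i ω = Function.update (padEvents w) n k i} := by
    rw [h1]
    ext ω
    simp only [Set.mem_inter_iff, Set.mem_ofPred_eq]
    constructor
    · rintro ⟨h, h'⟩ i hi
      rcases Nat.lt_succ_iff_lt_or_eq.1 hi with hi | rfl
      · rw [hlt i hi]; exact h i hi
      · simpa using h'
    · intro h
      refine ⟨fun i hi => ?_, ?_⟩
      · rw [← hlt i hi]; exact h i (by omega)
      · simpa using h n (by omega)
  rw [h2, h1, measureReal_def, measureReal_def, hL.event_law, hL.event_law,
    Finset.prod_range_succ, ENNReal.toReal_mul]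
  congr 1
  · congr 1
    refine Finset.prod_congr rfl fun i hi => ?_
    have hi' := Finset.mem_range.1 hi
    rw [hlt i hi', chainPath_congr nxt s₀ fun j hj => hlt j (by omega)]
  · rw [chainPath_congr nxt s₀ hlt]
    simp [ENNReal.toReal_ofReal (hp _ _)]

/-- The Markov property in integrated form, which replaces conditional expectations throughout. Only
finitely many histories of length `n` exist, so both integrals are finite sums over cylinders,
compared one by one. -/
theorem integral_mul_step [IsProbabilityMeasure P] (hL : HasChainLaw p nxt s₀ e P)
    (hp : ∀ s k, 0 ≤ p s k) {n : ℕ}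
    {g : (ℕ → Event) → ℝ} (hg : DependsOnFirst n g) (h : S → Event → ℝ) :
    ∫ ω, g (fun i => e i ω) * h (chainPath nxt s₀ (fun i => e i ω) n) (e n ω) ∂P
      = ∫ ω, g (fun i => e i ω) * ∑ k, p (chainPath nxt s₀ (fun i => e i ω) n) k
          * h (chainPath nxt s₀ (fun i => e i ω) n) k ∂P := by
  classical
  set A : (Fin n → Event) → Set Ω := fun w => {ω | (fun i : Fin n => e i ω) = w} with hA
  set B : Event → Set Ω := fun k => {ω | e n ω = k} with hB
  have mA : ∀ w, MeasurableSet (A w) := fun w =>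
    measurable_history hL.measurable_event n (measurableSet_singleton w)
  have mB : ∀ k, MeasurableSet (B k) := fun k => hL.measurable_event n (measurableSet_singleton k)
  have hpath : ∀ ω, chainPath nxt s₀ (fun i => e i ω) n
      = chainPath nxt s₀ (padEvents fun i : Fin n => e i ω) n := fun ω =>
    chainPath_congr nxt s₀ fun i hi => by simp [padEvents, hi]
  have key : ∀ (F : (Fin n → Event) → Event → ℝ), ∫ ω, F (fun i => e i ω) (e n ω) ∂P
      = ∑ w, ∑ k, P.real (A w ∩ B k) * F w k := by
    intro F
    have : ∀ ω, F (fun i => e i ω) (e n ω)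
        = ∑ w, ∑ k, (A w ∩ B k).indicator (fun _ => F w k) ω := by
      intro ω
      rw [Finset.sum_eq_single (fun i : Fin n => e i ω), Finset.sum_eq_single (e n ω)]
      · simp [hA, hB]
      · intro k _ hk
        exact Set.indicator_of_notMem (fun h => hk h.2.symm) _
      · simp
      · intro w _ hw
        exact Finset.sum_eq_zero fun k _ =>
          Set.indicator_of_notMem (fun h => hw h.1.symm) _
      · simp
    simp_rw [this]
    rw [integral_finsetSum]
    · refine Finset.sum_congr rfl fun w _ => ?_
      rw [integral_finsetSum]
      · refine Finset.sum_congr rfl fun k _ => ?_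
        rw [integral_indicator_const _ ((mA w).inter (mB k)), smul_eq_mul]
      · exact fun k _ => (integrable_const _).indicator ((mA w).inter (mB k))
    · exact fun w _ => integrable_finsetSum _ fun k _ =>
        (integrable_const _).indicator ((mA w).inter (mB k))
  have hsum : ∀ w, ∑ k, P.real (A w ∩ B k) = P.real (A w) := by
    intro w
    have := key fun v _ => if v = w then 1 else 0
    have h2 : ∫ ω, (if (fun i : Fin n => e i ω) = w then (1 : ℝ) else 0) ∂P = P.real (A w) := by
      rw [show (fun ω => if (fun i : Fin n => e i ω) = w then (1 : ℝ) else 0)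
        = (A w).indicator fun _ => 1 from by
          funext ω; simp [hA, Set.indicator_apply]]
      rw [integral_indicator_const _ (mA w)]; simp
    rw [h2] at this
    rw [this, Finset.sum_eq_single w]
    · simp
    · intro v _ hv; simp [hv]
    · simp
  have e1 := key fun w k => g (padEvents w) * h (chainPath nxt s₀ (padEvents w) n) k
  have e2 := key fun w _ => g (padEvents w) * ∑ k, p (chainPath nxt s₀ (padEvents w) n) k
          * h (chainPath nxt s₀ (padEvents w) n) k
  have hgp : ∀ ω, g (padEvents fun i : Fin n => e i ω) = g (fun i => e i ω) := fun ω =>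
    (hg.eq_pad fun i => e i ω).symm
  simp only [← hpath, hgp] at e1 e2
  rw [e1, e2]
  refine Finset.sum_congr rfl fun w _ => ?_
  rw [← Finset.sum_mul, hsum, Finset.mul_sum, Finset.mul_sum]
  refine Finset.sum_congr rfl fun k _ => ?_
  rw [hL.measure_cylinder_inter hp]
  ring

end HasChainLaw

/-- Averages of orthogonal, uniformly square-integrable variables tend to zero almost surely
along the squares. -/
theorem tendsto_avg_sq_of_orthogonal {P : Measure Ω} {D : ℕ → Ω → ℝ}
    (hint : ∀ i j, Integrable (fun ω => D i ω * D j ω) P)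
    (hmeas : ∀ i, AEMeasurable (D i) P)
    (horth : ∀ i j, i < j → ∫ ω, D i ω * D j ω ∂P = 0)
    {K : ℝ} (hK : ∀ i, ∫ ω, D i ω * D i ω ∂P ≤ K) :
    ∀ᵐ ω ∂P, Tendsto (fun n : ℕ => (∑ i ∈ Finset.range (n ^ 2), D i ω) / ((n ^ 2 : ℕ) : ℝ))
      atTop (𝓝 0) := by
  have hK0 : 0 ≤ K := (integral_nonneg fun ω => mul_self_nonneg (D 0 ω)).trans (hK 0)
  have hvar : ∀ m, ∫ ω, (∑ i ∈ Finset.range m, D i ω) ^ 2 ∂P ≤ m * K := by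
    intro m
    have h1 : ∀ ω, (∑ i ∈ Finset.range m, D i ω) ^ 2
        = ∑ i ∈ Finset.range m, ∑ j ∈ Finset.range m, D i ω * D j ω := fun ω => by
      rw [sq, Finset.sum_mul_sum]
    simp_rw [h1]
    rw [integral_finsetSum _ fun i _ => integrable_finsetSum _ fun j _ => hint i j]
    have h2 : ∀ i ∈ Finset.range m,
        ∫ ω, ∑ j ∈ Finset.range m, D i ω * D j ω ∂P ≤ K := by
      intro i hi
      rw [integral_finsetSum _ fun j _ => hint i j, Finset.sum_eq_single i]
      · exact hK i
      · intro j _ hj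
        rcases lt_or_gt_of_ne hj with h | h
        · simp_rw [mul_comm (D i _)]; exact horth j i h
        · exact horth i j h
      · exact fun h => absurd hi h
    simpa using Finset.sum_le_sum h2
  set Z : ℕ → Ω → ℝ := fun n ω => (∑ i ∈ Finset.range (n ^ 2), D i ω) / ((n ^ 2 : ℕ) : ℝ) with hZ
  have hsqint : ∀ n, Integrable (fun ω => Z n ω ^ 2) P := by
    intro n
    have : (fun ω => Z n ω ^ 2) = fun ω => (∑ i ∈ Finset.range (n ^ 2),
        ∑ j ∈ Finset.range (n ^ 2), D i ω * D j ω) / ((n ^ 2 : ℕ) : ℝ) ^ 2 := by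
      funext ω; rw [hZ]; simp only [div_pow]; rw [sq (∑ i ∈ _, D i ω), Finset.sum_mul_sum]
    rw [this]
    exact (integrable_finsetSum _ fun i _ => integrable_finsetSum _ fun j _ => hint i j).div_const _
  have hZm : ∀ n, AEMeasurable (Z n) P := fun n =>
    (Finset.aemeasurable_fun_sum _ fun i _ => hmeas i).div_const _
  -- The variance of an average of `m` terms is at most `K / m`. Along `m = n ^ 2` these bounds are
  -- summable, so `∑ Z n ^ 2` is almost surely finite and its terms tend to zero.
  have hbd : ∀ n, ∫⁻ ω, ENNReal.ofReal (Z n ω ^ 2) ∂P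
      ≤ ENNReal.ofReal (K * (1 / (n : ℝ) ^ 2)) := by
    intro n
    rw [← ofReal_integral_eq_lintegral_ofReal (hsqint n) (ae_of_all _ fun ω => sq_nonneg _)]
    apply ENNReal.ofReal_le_ofReal
    simp only [hZ, div_pow]
    rw [integral_div]
    rcases Nat.eq_zero_or_pos n with rfl | hn
    · simp
    · have hn' : (0 : ℝ) < n := by exact_mod_cast hn
      rw [div_le_iff₀ (by positivity)]
      refine (hvar _).trans (le_of_eq ?_)
      push_cast; field_simp
  have hfin : ∫⁻ ω, ∑' n, ENNReal.ofReal (Z n ω ^ 2) ∂P ≠ ⊤ := by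
    rw [lintegral_tsum fun n => ((hZm n).pow_const 2).ennreal_ofReal]
    refine ne_top_of_le_ne_top ?_ (ENNReal.tsum_le_tsum hbd)
    have hs : Summable fun n : ℕ => K * (1 / (n : ℝ) ^ 2) :=
      (Real.summable_one_div_nat_pow.2 one_lt_two).mul_left K
    exact hs.tsum_ofReal_ne_top
  have hae := ae_lt_top' (AEMeasurable.tsum
    fun n => ((hZm n).pow_const 2).ennreal_ofReal) hfin
  filter_upwards [hae] with ω hω
  have h0 : Tendsto (fun n => ENNReal.ofReal (Z n ω ^ 2)) atTop (𝓝 0) :=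
    ENNReal.tendsto_atTop_zero_of_tsum_ne_top hω.ne
  have h1 : Tendsto (fun n => Z n ω ^ 2) atTop (𝓝 0) := by
    have := (ENNReal.tendsto_toReal ENNReal.zero_ne_top).comp h0
    refine this.congr fun n => ?_
    simp [ENNReal.toReal_ofReal (sq_nonneg _)]
  have h2 := h1.sqrt
  simp only [Real.sqrt_zero, Real.sqrt_sq_eq_abs] at h2
  exact (tendsto_zero_iff_abs_tendsto_zero _).2 h2

namespace HasChainLaw

variable {p : S → Event → ℝ} {nxt : S → Event → S} {s₀ : S} {e : ℕ → Ω → Event}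
  {P : Measure Ω} [IsProbabilityMeasure P]

/-- Strong law for the martingale differences of a functional of the transitions. -/
theorem tendsto_avg_martingale (hL : HasChainLaw p nxt s₀ e P) (hp : ∀ s k, 0 ≤ p s k)
    (hp1 : ∀ s, ∑ k, p s k = 1) (h : S → Event → ℝ) {K : ℝ}
    (hK : ∀ n, ∫ ω, h (chainPath nxt s₀ (fun i => e i ω) n) (e n ω) ^ 2 ∂P ≤ K) :
    ∀ᵐ ω ∂P, Tendsto (fun n : ℕ => (∑ i ∈ Finset.range (n ^ 2),
      (h (chainPath nxt s₀ (fun j => e j ω) i) (e i ω)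
        - ∑ k, p (chainPath nxt s₀ (fun j => e j ω) i) k
          * h (chainPath nxt s₀ (fun j => e j ω) i) k)) / ((n ^ 2 : ℕ) : ℝ)) atTop (𝓝 0) := by
  set D : S → Event → ℝ := fun s k => h s k - ∑ k', p s k' * h s k' with hD
  have hmean : ∀ s, ∑ k, p s k * D s k = 0 := by
    intro s
    simp only [hD, mul_sub, Finset.sum_sub_distrib, ← Finset.sum_mul, hp1]
    ring
  have hdep : ∀ i, DependsOnFirst (i + 1) fun a => D (chainPath nxt s₀ a i) (a i) :=
    dependsOnFirst_step nxt s₀ D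
  have he := hL.measurable_event
  refine tendsto_avg_sq_of_orthogonal (K := K)
    (D := fun i ω => D (chainPath nxt s₀ (fun j => e j ω) i) (e i ω)) ?_ ?_ ?_ ?_
  · intro i j
    exact (((hdep i).mono (Nat.le_add_right _ (j + 1))).mul
      ((hdep j).mono (Nat.le_add_left _ (i + 1)))).integrable he
  · intro i
    exact ((hdep i).integrable (P := P) he).aemeasurable
  -- The factor with index `i` depends only on the first `i + 1 ≤ j` transitions, and `D` has mean
  -- zero under every `p s`.
  · intro i j hij
    rw [hL.integral_mul_step hp ((hdep i).mono hij) D]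
    simp [hmean]
  · intro n
    refine le_trans ?_ (hK n)
    set m : S → ℝ := fun s => ∑ k', p s k' * h s k'
    have i1 : Integrable (fun ω => h (chainPath nxt s₀ (fun i => e i ω) n) (e n ω) ^ 2) P :=
      (dependsOnFirst_step nxt s₀ (fun s k => h s k ^ 2) n).integrable he
    have i2 : Integrable (fun ω => m (chainPath nxt s₀ (fun i => e i ω) n)
        * D (chainPath nxt s₀ (fun i => e i ω) n) (e n ω)) P :=
      (dependsOnFirst_step nxt s₀ (fun s k => m s * D s k) n).integrable he
    have i3 : Integrable (fun ω => m (chainPath nxt s₀ (fun i => e i ω) n) ^ 2) P :=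
      (dependsOnFirst_state nxt s₀ (fun s => m s ^ 2) n).integrable he
    have z : ∫ ω, m (chainPath nxt s₀ (fun i => e i ω) n)
        * D (chainPath nxt s₀ (fun i => e i ω) n) (e n ω) ∂P = 0 := by
      rw [hL.integral_mul_step hp (dependsOnFirst_state nxt s₀ m n) D]
      simp [hmean]
    have : ∀ ω, D (chainPath nxt s₀ (fun i => e i ω) n) (e n ω)
        * D (chainPath nxt s₀ (fun i => e i ω) n) (e n ω)
        = (h (chainPath nxt s₀ (fun i => e i ω) n) (e n ω) ^ 2
          - 2 * (m (chainPath nxt s₀ (fun i => e i ω) n)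
            * D (chainPath nxt s₀ (fun i => e i ω) n) (e n ω)))
          - m (chainPath nxt s₀ (fun i => e i ω) n) ^ 2 := by
      intro ω; simp only [hD, m]; ring
    have i4 : Integrable (fun ω => h (chainPath nxt s₀ (fun i => e i ω) n) (e n ω) ^ 2
          - 2 * (m (chainPath nxt s₀ (fun i => e i ω) n)
            * D (chainPath nxt s₀ (fun i => e i ω) n) (e n ω))) P := i1.sub (i2.const_mul 2)
    simp_rw [this]
    rw [integral_sub i4 i3, integral_sub i1 (i2.const_mul 2),
      integral_const_mul, z]
    have : 0 ≤ ∫ ω, m (chainPath nxt s₀ (fun i => e i ω) n) ^ 2 ∂P :=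
      integral_nonneg fun ω => sq_nonneg _
    linarith

end HasChainLaw

end

/-! ### Exponential clocks and their replacement by means. -/

section

theorem measurable_gammaPDF_one : Measurable (gammaPDF 1 1) :=
  (measurable_gammaPDFReal 1 1).ennreal_ofReal

theorem integrable_pow_expMeasure (n : ℕ) : Integrable (fun x : ℝ => x ^ n) (expMeasure 1) := by
  have h := Real.GammaIntegral_convergent (s := n + 1) (by positivity)
  rw [expMeasure, gammaMeasure, integrable_withDensity_iff_integrable_smul'
    measurable_gammaPDF_one (ae_of_all _ fun x => ENNReal.ofReal_lt_top)]
  rw [← integrableOn_Ici_iff_integrableOn_Ioi, ← integrable_indicator_iff measurableSet_Ici] at h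
  refine h.congr (ae_of_all _ fun x => ?_)
  by_cases hx : 0 ≤ x
  · rw [Set.indicator_of_mem (show x ∈ Set.Ici (0 : ℝ) from hx)]
    simp [gammaPDF, gammaPDFReal, hx, ENNReal.toReal_ofReal (Real.exp_pos _).le]
  · rw [Set.indicator_of_notMem (show x ∉ Set.Ici (0 : ℝ) from hx)]
    simp [gammaPDF, gammaPDFReal, hx]

theorem integral_id_expMeasure : ∫ x, x ∂(expMeasure 1) = 1 := by
  have h := Real.Gamma_eq_integral (s := 2) (by norm_num)
  rw [Real.Gamma_two, ← integral_Ici_eq_integral_Ioi,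
    ← integral_indicator measurableSet_Ici] at h
  refine Eq.trans ?_ h.symm
  rw [expMeasure, gammaMeasure, integral_withDensity_eq_integral_toReal_smul
    measurable_gammaPDF_one (ae_of_all _ fun x => ENNReal.ofReal_lt_top)]
  refine integral_congr_ae (ae_of_all _ fun x => ?_)
  by_cases hx : 0 ≤ x
  · simp only [Set.indicator_of_mem (show x ∈ Set.Ici (0 : ℝ) from hx)]
    simp [gammaPDF, gammaPDFReal, hx, ENNReal.toReal_ofReal (Real.exp_pos _).le]
    norm_num
  · simp only [Set.indicator_of_notMem (show x ∉ Set.Ici (0 : ℝ) from hx)]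
    simp [gammaPDF, gammaPDFReal, hx]

theorem ae_nonneg_expMeasure : ∀ᵐ x ∂(expMeasure 1), 0 ≤ x := by
  rw [expMeasure, gammaMeasure, ae_withDensity_iff measurable_gammaPDF_one]
  refine ae_of_all _ fun x hx => ?_
  by_contra h
  exact hx (gammaPDF_of_neg (not_le.1 h))

variable {Ω : Type*} [MeasurableSpace Ω] {S : Type*}

/-- Given the states of the chain, independent standard exponential clocks may be replaced by
their means in the averages. -/
theorem tendsto_avg_clock {P : Measure Ω} [IsProbabilityMeasure P] (nxt : S → Event → S) (s₀ : S)
    {e : ℕ → Ω → Event} {ξ : ℕ → Ω → ℝ}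
    (he : ∀ n, Measurable (e n)) (hξ : ∀ n, Measurable (ξ n))
    (hlaw : ∀ n, P.map (ξ n) = expMeasure 1) (hind : iIndepFun ξ P)
    (heξ : IndepFun (fun ω n => e n ω) (fun ω n => ξ n ω) P)
    (f : S → ℝ) {K : ℝ}
    (hK : ∀ n, ∫ ω, f (chainPath nxt s₀ (fun i => e i ω) n) ^ 2 ∂P ≤ K) :
    ∀ᵐ ω ∂P, Tendsto (fun n : ℕ => (∑ i ∈ Finset.range (n ^ 2),
      f (chainPath nxt s₀ (fun j => e j ω) i) * (ξ i ω - 1)) / ((n ^ 2 : ℕ) : ℝ))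
      atTop (𝓝 0) := by
  have he' : Measurable fun ω n => e n ω := measurable_pi_lambda _ he
  have hξ' : Measurable fun ω n => ξ n ω := measurable_pi_lambda _ hξ
  have ii : ∀ m i, Integrable (fun ω => ξ i ω ^ m) P := by
    intro m i
    have := integrable_pow_expMeasure m
    rw [← hlaw i] at this
    exact this.comp_measurable (hξ i)
  have i1 : ∀ i, Integrable (fun ω => ξ i ω - 1) P := fun i => by
    refine ((ii 1 i).sub (integrable_const (1 : ℝ))).congr (ae_of_all _ fun ω => ?_)
    simp
  have z1 : ∀ i, ∫ ω, (ξ i ω - 1) ∂P = 0 := by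
    intro i
    have h1 : ∫ ω, ξ i ω ∂P = 1 := by
      rw [← integral_id_expMeasure, ← hlaw i, integral_map (hξ i).aemeasurable (by fun_prop)]
    have h2 : Integrable (fun ω => ξ i ω) P := by simpa using ii 1 i
    rw [integral_sub h2 (integrable_const _), h1]; simp
  have i2 : ∀ i j, Integrable (fun ω => (ξ i ω - 1) * (ξ j ω - 1)) P := by
    intro i j
    by_cases hij : i = j
    · subst hij
      have := ((ii 2 i).sub ((ii 1 i).const_mul 2)).add (integrable_const (1 : ℝ))
      refine this.congr (ae_of_all _ fun ω => ?_)
      simp; ring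
    · exact ((hind.indepFun hij).comp (φ := fun x : ℝ => x - 1) (ψ := fun x : ℝ => x - 1)
        (by fun_prop) (by fun_prop)).integrable_mul (i1 i) (i1 j)
  have z2 : ∀ i j, i ≠ j → ∫ ω, (ξ i ω - 1) * (ξ j ω - 1) ∂P = 0 := by
    intro i j hij
    have := (hind.indepFun hij).integral_fun_comp_mul_comp (f := fun x : ℝ => x - 1)
      (g := fun x : ℝ => x - 1) (hξ i).aemeasurable (hξ j).aemeasurable
      (by fun_prop) (by fun_prop)
    rw [this, z1, zero_mul]
  obtain ⟨c, hc0, hc⟩ : ∃ c : ℝ, 0 ≤ c ∧ ∀ i, ∫ ω, (ξ i ω - 1) * (ξ i ω - 1) ∂P = c := by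
    refine ⟨∫ x, (x - 1) * (x - 1) ∂(expMeasure 1),
      integral_nonneg fun x => mul_self_nonneg _, fun i => ?_⟩
    rw [← hlaw i, integral_map (hξ i).aemeasurable (by fun_prop)]
  have hdep : ∀ i, DependsOnFirst i fun a => f (chainPath nxt s₀ a i) :=
    dependsOnFirst_state nxt s₀ f
  have hdep2 : ∀ i j, DependsOnFirst (i + j) fun a =>
      f (chainPath nxt s₀ a i) * f (chainPath nxt s₀ a j) := fun i j =>
    ((hdep i).mono (Nat.le_add_right i j)).mul ((hdep j).mono (Nat.le_add_left j i))
  have hψ : ∀ i j, Measurable fun x : ℕ → ℝ => (x i - 1) * (x j - 1) := fun i j => by fun_prop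
  -- The events are independent of the clocks, so the products factor; for `i ≠ j` the clock factor
  -- vanishes because the centred clocks are independent.
  have hprod : ∀ i j, Integrable (fun ω => (f (chainPath nxt s₀ (fun j => e j ω) i)
      * f (chainPath nxt s₀ (fun i => e i ω) j)) * ((ξ i ω - 1) * (ξ j ω - 1))) P := fun i j =>
    (heξ.comp (hdep2 i j).measurable (hψ i j)).integrable_mul ((hdep2 i j).integrable he) (i2 i j)
  have hval : ∀ i j, ∫ ω, (f (chainPath nxt s₀ (fun j => e j ω) i)
      * f (chainPath nxt s₀ (fun i => e i ω) j)) * ((ξ i ω - 1) * (ξ j ω - 1)) ∂P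
      = (∫ ω, f (chainPath nxt s₀ (fun j => e j ω) i) * f (chainPath nxt s₀ (fun i => e i ω) j) ∂P)
        * ∫ ω, (ξ i ω - 1) * (ξ j ω - 1) ∂P := fun i j =>
    heξ.integral_fun_comp_mul_comp
      (f := fun a => f (chainPath nxt s₀ a i) * f (chainPath nxt s₀ a j))
      he'.aemeasurable hξ'.aemeasurable
      (hdep2 i j).measurable.aestronglyMeasurable (hψ i j).aestronglyMeasurable
  have hcomm : ∀ i j ω, f (chainPath nxt s₀ (fun j => e j ω) i) * (ξ i ω - 1)
      * (f (chainPath nxt s₀ (fun j => e j ω) j) * (ξ j ω - 1))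
      = (f (chainPath nxt s₀ (fun j => e j ω) i) * f (chainPath nxt s₀ (fun i => e i ω) j))
        * ((ξ i ω - 1) * (ξ j ω - 1)) := fun i j ω => by ring
  refine tendsto_avg_sq_of_orthogonal (K := K * c)
    (D := fun i ω => f (chainPath nxt s₀ (fun j => e j ω) i) * (ξ i ω - 1)) ?_ ?_ ?_ ?_
  · intro i j
    simp_rw [hcomm]
    exact hprod i j
  · intro i
    exact (((hdep i).integrable (P := P) he).aemeasurable).mul ((i1 i).aemeasurable)
  · intro i j hij
    simp_rw [hcomm]
    rw [hval, z2 i j hij.ne, mul_zero]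
  · intro i
    simp_rw [hcomm]
    rw [hval, hc]
    refine mul_le_mul_of_nonneg_right ?_ hc0
    simpa [sq] using hK i

end

/-! ### Limits of tight families of positive functionals. -/

section

/-- A tight family of positive functionals has, along an ultrafilter, a limit given by a summable
weight. -/
theorem exists_ultrafilter_limit {ι S : Type*} (A : ι → (S → ℝ) →ₗ[ℝ] ℝ)
    (hpos : ∀ n f, (∀ s, 0 ≤ f s) → 0 ≤ A n f) {W : S → ℝ} (hW : ∀ s, 1 ≤ W s) {K : ℝ}
    (hK : ∀ n, A n W ≤ K) (U : Ultrafilter ι) :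
    ∃ l : S → ℝ, (∀ s, 0 ≤ l s) ∧ ∀ f : S → ℝ, (∀ ε > 0, {s | ε * W s < |f s|}.Finite) →
      Summable (fun s => l s * f s) ∧ Tendsto (fun n => A n f) U (𝓝 (∑' s, l s * f s)) := by
  classical
  have hmono : ∀ n f g, (∀ s, f s ≤ g s) → A n f ≤ A n g := by
    intro n f g h
    have := hpos n (g - f) fun s => sub_nonneg.2 (h s)
    rw [map_sub] at this
    linarith
  have hW0 : ∀ s, 0 ≤ W s := fun s => zero_le_one.trans (hW s)
  have hsingle : ∀ s n, A n (Pi.single s 1) ∈ Set.Icc 0 K := by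
    intro s n
    refine ⟨hpos n _ fun t => ?_, (hmono n _ _ fun t => ?_).trans (hK n)⟩
    · by_cases h : t = s
      · subst h; simp
      · simp [h]
    · by_cases h : t = s
      · subst h; simpa using hW t
      · simpa [h] using hW0 t
  -- The values on point masses stay in the compact interval `[0, K]`, so the ultrafilter has a
  -- limit there for every state at once.
  have hex : ∀ s, ∃ x ∈ Set.Icc 0 K, Tendsto (fun n => A n (Pi.single s 1)) U (𝓝 x) := by
    intro s
    exact isCompact_Icc.ultrafilter_le_nhds (U.map fun n => A n (Pi.single s 1))
      (le_principal_iff.2 (Filter.mem_map.2 (Filter.univ_mem' fun n => hsingle s n)))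
  choose l hl htl using hex
  have hfin : ∀ (F : Finset S) (f : S → ℝ),
      Tendsto (fun n => A n (fun s => if s ∈ F then f s else 0)) U (𝓝 (∑ s ∈ F, l s * f s)) := by
    intro F f
    have hf : (fun s => if s ∈ F then f s else 0)
        = ∑ t ∈ F, f t • (Pi.single t 1 : S → ℝ) := by
      funext s
      rw [Finset.sum_apply]
      simp only [Pi.smul_apply, Pi.single_apply, smul_eq_mul, mul_ite, mul_one, mul_zero]
      rw [Finset.sum_ite_eq]
    simp_rw [hf, map_sum, map_smul, smul_eq_mul]
    refine tendsto_finsetSum _ fun s _ => ?_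
    rw [mul_comm]
    exact (htl s).const_mul _
  have hlW : Summable fun s => l s * W s := by
    refine summable_of_sum_le (c := K) (fun s => mul_nonneg (hl s).1 (hW0 s)) fun F => ?_
    refine le_of_tendsto (hfin F W) (univ_mem' fun n => (hmono n _ _ fun s => ?_).trans (hK n))
    split_ifs
    · exact le_rfl
    · exact hW0 s
  refine ⟨l, fun s => (hl s).1, fun f hf => ?_⟩
  have hs : Summable fun s => l s * f s := by
    refine Summable.of_norm_bounded_eventually hlW ?_
    have h1 := hf 1 one_pos
    filter_upwards [h1.compl_mem_cofinite] with s hs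
    have : |f s| ≤ W s := by simpa using hs
    rw [norm_mul, Real.norm_eq_abs, Real.norm_eq_abs, abs_of_nonneg (hl s).1]
    exact mul_le_mul_of_nonneg_left this (hl s).1
  refine ⟨hs, ?_⟩
  rw [Metric.tendsto_nhds]
  intro ε hε
  have hK0 : 0 ≤ K := by
    obtain ⟨n⟩ : Nonempty ι := Filter.nonempty_of_neBot (U : Filter ι)
    exact (hpos n W hW0).trans (hK n)
  set δ : ℝ := ε / (3 * (K + 1)) with hδ
  have hδ0 : 0 < δ := by positivity
  -- Outside `F` one has `|f| ≤ δ W`, so truncating `f` to `F` changes every functional by at most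
  -- `δ K < ε / 3`, uniformly in the index.
  obtain ⟨F, hF0, hF⟩ : ∃ F : Finset S, (hf δ hδ0).toFinset ⊆ F ∧
      dist (∑ s ∈ F, l s * f s) (∑' s, l s * f s) < ε / 3 :=
    ((eventually_ge_atTop (hf δ hδ0).toFinset).and
      ((Metric.tendsto_nhds.1 hs.hasSum) (ε / 3) (by positivity))).exists
  filter_upwards [(Metric.tendsto_nhds.1 (hfin F f)) (ε / 3) (by positivity)] with n hn
  have hb : ∀ s, |f s - (if s ∈ F then f s else 0)| ≤ δ * W s := by
    intro s
    by_cases h : s ∈ F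
    · simpa [h] using mul_nonneg hδ0.le (hW0 s)
    · have : s ∉ (hf δ hδ0).toFinset := fun h' => h (hF0 h')
      simpa [h] using this
  have hd : |A n f - A n (fun s => if s ∈ F then f s else 0)| ≤ δ * K := by
    have e1 := hmono n (f - fun s => if s ∈ F then f s else 0) (δ • W)
      fun s => (abs_le.1 (hb s)).2
    have e2 := hmono n (-(δ • W)) (f - fun s => if s ∈ F then f s else 0)
      fun s => (abs_le.1 (hb s)).1
    rw [map_sub, map_smul, smul_eq_mul] at e1
    rw [map_sub, map_neg, map_smul, smul_eq_mul] at e2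
    have e3 := mul_le_mul_of_nonneg_left (hK n) hδ0.le
    rw [abs_le]
    constructor <;> linarith
  have hδK : δ * K < ε / 3 := by
    rw [hδ, div_mul_eq_mul_div, div_lt_div_iff₀ (by positivity) (by norm_num)]
    nlinarith
  rw [Real.dist_eq] at *
  have t1 := abs_add_le (A n f - A n (fun s => if s ∈ F then f s else 0))
    (A n (fun s => if s ∈ F then f s else 0) - ∑ s ∈ F, l s * f s)
  have t2 := abs_add_le (A n f - ∑ s ∈ F, l s * f s)
    ((∑ s ∈ F, l s * f s) - ∑' s, l s * f s)
  rw [sub_add_sub_cancel] at t1 t2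
  linarith

/-! ### The tandem queue and uniqueness of its invariant measure. -/

/-- Transition rates of two exponential queues in tandem. -/
def tandemRate (μ l : ℝ) (s : ℕ × ℕ) : Event → ℝ
  | Event.order => 1
  | Event.prepared => if 0 < s.1 then μ else 0
  | Event.rider => if 0 < s.2 then l else 0

/-- Transitions of two queues in tandem. -/
def tandemNext (s : ℕ × ℕ) : Event → ℕ × ℕ
  | Event.order => (s.1 + 1, s.2)
  | Event.prepared => (s.1 - 1, s.2 + 1)
  | Event.rider => (s.1, s.2 - 1)

/-- Total rate of leaving a state of the tandem queue. -/
def tandemTotal (μ l : ℝ) (s : ℕ × ℕ) : ℝ := ∑ k, tandemRate μ l s k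

/-- Generator of the tandem queue. -/
def tandemGen (μ l : ℝ) (g : ℕ × ℕ → ℝ) (s : ℕ × ℕ) : ℝ :=
  ∑ k, tandemRate μ l s k * (g (tandemNext s k) - g s)

/-- Product of the geometric distributions with ratios `x` and `y`. -/
def geomProd (x y : ℝ) (s : ℕ × ℕ) : ℝ := ((1 - x) * x ^ s.1) * ((1 - y) * y ^ s.2)

theorem tandemRate_nonneg {μ l : ℝ} (hμ : 0 ≤ μ) (hl : 0 ≤ l) (s : ℕ × ℕ) (k : Event) :
    0 ≤ tandemRate μ l s k := by
  cases k <;> simp only [tandemRate] <;> positivity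

theorem one_le_tandemTotal {μ l : ℝ} (hμ : 0 ≤ μ) (hl : 0 ≤ l) (s : ℕ × ℕ) :
    1 ≤ tandemTotal μ l s := by
  have h1 := tandemRate_nonneg hμ hl s Event.prepared
  have h2 := tandemRate_nonneg hμ hl s Event.rider
  rw [tandemTotal, sum_event]
  simp only [tandemRate] at *
  linarith

theorem tandemTotal_le {μ l : ℝ} (hμ : 0 ≤ μ) (hl : 0 ≤ l) (s : ℕ × ℕ) :
    tandemTotal μ l s ≤ 1 + μ + l := by
  rw [tandemTotal, sum_event]
  simp only [tandemRate]
  split_ifs <;> linarith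

theorem abs_tandemGen_le {μ l : ℝ} (hμ : 0 ≤ μ) (hl : 0 ≤ l) {g : ℕ × ℕ → ℝ} {C : ℝ}
    (hg : ∀ s, |g s| ≤ C) (s : ℕ × ℕ) : |tandemGen μ l g s| ≤ (1 + μ + l) * (2 * C) := by
  have hC : 0 ≤ C := (abs_nonneg _).trans (hg s)
  calc |tandemGen μ l g s| ≤ ∑ k, |tandemRate μ l s k * (g (tandemNext s k) - g s)| :=
        Finset.abs_sum_le_sum_abs _ _
    _ ≤ ∑ k, tandemRate μ l s k * (2 * C) := by
        refine Finset.sum_le_sum fun k _ => ?_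
        rw [abs_mul, abs_of_nonneg (tandemRate_nonneg hμ hl s k)]
        refine mul_le_mul_of_nonneg_left ?_ (tandemRate_nonneg hμ hl s k)
        have := abs_sub (g (tandemNext s k)) (g s)
        linarith [hg (tandemNext s k), hg s]
    _ = tandemTotal μ l s * (2 * C) := by rw [← Finset.sum_mul]; rfl
    _ ≤ _ := mul_le_mul_of_nonneg_right (tandemTotal_le hμ hl s) (by positivity)

theorem summable_mul_of_bounded {S : Type*} {σ h : S → ℝ} (hσ : Summable σ) {C : ℝ}
    (hh : ∀ s, |h s| ≤ C) : Summable fun s => σ s * h s := by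
  refine Summable.of_norm_bounded (hσ.abs.mul_right C) fun s => ?_
  rw [norm_mul, Real.norm_eq_abs, Real.norm_eq_abs]
  exact mul_le_mul_of_nonneg_left (hh s) (abs_nonneg _)

/-- A signed measure that annihilates the generator on point masses annihilates it on bounded
functions. -/
theorem tsum_mul_tandemGen_eq_zero {μ l : ℝ} (hμ : 0 ≤ μ) (hl : 0 ≤ l) {σ : ℕ × ℕ → ℝ}
    (hσ : Summable σ) (hbal : ∀ t, ∑' s, σ s * tandemGen μ l (Pi.single t 1) s = 0)
    {g : ℕ × ℕ → ℝ} {C : ℝ} (hg : ∀ s, |g s| ≤ C) : ∑' s, σ s * tandemGen μ l g s = 0 := by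
  have hC : 0 ≤ C := (abs_nonneg _).trans (hg (0, 0))
  set gF : Finset (ℕ × ℕ) → ℕ × ℕ → ℝ := fun F s => if s ∈ F then g s else 0 with hgF
  have hgFb : ∀ F s, |gF F s| ≤ C := by
    intro F s
    simp only [hgF]
    split_ifs
    · exact hg s
    · simpa using hC
  have hsingle : ∀ t s : ℕ × ℕ, |(Pi.single t 1 : ℕ × ℕ → ℝ) s| ≤ 1 := by
    intro t s
    rw [Pi.single_apply]; split_ifs <;> simp
  have hzero : ∀ F, ∑' s, σ s * tandemGen μ l (gF F) s = 0 := by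
    intro F
    have h1 : ∀ s, gF F s = ∑ t ∈ F, g t * (Pi.single t 1 : ℕ × ℕ → ℝ) s := by
      intro s
      simp only [hgF, Pi.single_apply, mul_ite, mul_one, mul_zero]
      rw [Finset.sum_ite_eq]
    have h2 : ∀ s, σ s * tandemGen μ l (gF F) s
        = ∑ t ∈ F, g t * (σ s * tandemGen μ l (Pi.single t 1) s) := by
      intro s
      simp only [tandemGen, h1, ← Finset.sum_sub_distrib, Finset.mul_sum]
      rw [Finset.sum_comm]
      refine Finset.sum_congr rfl fun t _ => Finset.sum_congr rfl fun k _ => ?_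
      ring
    simp_rw [h2]
    rw [Summable.tsum_finsetSum fun t _ => (summable_mul_of_bounded hσ
      (abs_tandemGen_le hμ hl (hsingle t))).mul_left _]
    refine Finset.sum_eq_zero fun t _ => ?_
    rw [tsum_mul_left, hbal, mul_zero]
  -- The truncations `gF F` share the bound `C` and the rates are bounded, so dominated convergence
  -- applies with `|σ|` as weight.
  have hlim : Tendsto (fun F => ∑' s, σ s * tandemGen μ l (gF F) s) atTop
      (𝓝 (∑' s, σ s * tandemGen μ l g s)) := by
    refine tendsto_tsum_of_dominated_convergence
      (bound := fun s => |σ s| * ((1 + μ + l) * (2 * C))) (hσ.abs.mul_right _) ?_ ?_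
    · intro s
      have hpt : ∀ t, Tendsto (fun F => gF F t) atTop (𝓝 (g t)) := by
        intro t
        refine tendsto_const_nhds.congr' ?_
        filter_upwards [eventually_ge_atTop {t}] with F hF
        have : t ∈ F := hF (by simp)
        simp [hgF, this]
      exact (tendsto_finsetSum _ fun k _ => ((hpt _).sub (hpt s)).const_mul _).const_mul _
    · refine Eventually.of_forall fun F s => ?_
      rw [norm_mul, Real.norm_eq_abs, Real.norm_eq_abs]
      exact mul_le_mul_of_nonneg_left (abs_tandemGen_le hμ hl (hgFb F) s) (abs_nonneg _)
  simp_rw [hzero] at hlim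
  exact (tendsto_nhds_unique hlim tendsto_const_nhds)

/-- The sign of an invariant signed measure is preserved by transitions. -/
theorem sign_next_eq {μ l : ℝ} (hμ : 0 ≤ μ) (hl : 0 ≤ l) {σ : ℕ × ℕ → ℝ}
    (hσ : Summable σ) (hbal : ∀ t, ∑' s, σ s * tandemGen μ l (Pi.single t 1) s = 0)
    {s : ℕ × ℕ} (hs : σ s ≠ 0) {k : Event} (hk : 0 < tandemRate μ l s k) :
    SignType.sign (σ (tandemNext s k)) = SignType.sign (σ s) := by
  -- Testing invariance against the sign of `σ` makes every term `σ s * (g t - g s)` nonpositive.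
  -- The sum is zero, so every term with positive rate vanishes.
  set g : ℕ × ℕ → ℝ := fun s => (SignType.sign (σ s) : ℝ) with hg
  have hgb : ∀ s, |g s| ≤ 1 := by
    intro s
    rcases lt_trichotomy (σ s) 0 with h | h | h <;> simp [hg, h]
  have hσg : ∀ s, σ s * g s = |σ s| := fun s => by rw [hg]; exact self_mul_sign (σ s)
  have hle : ∀ s t, σ s * (g t - g s) ≤ 0 := by
    intro s t
    rw [mul_sub, hσg]
    have : σ s * g t ≤ |σ s| * 1 := (le_abs_self _).trans (by
      rw [abs_mul]; exact mul_le_mul_of_nonneg_left (hgb t) (abs_nonneg _))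
    linarith
  have hterm : ∀ s k, 0 ≤ -(tandemRate μ l s k * (σ s * (g (tandemNext s k) - g s))) := fun s k =>
    neg_nonneg.2 (mul_nonpos_of_nonneg_of_nonpos (tandemRate_nonneg hμ hl s k) (hle _ _))
  have hexp : ∀ s, -(σ s * tandemGen μ l g s)
      = ∑ k, -(tandemRate μ l s k * (σ s * (g (tandemNext s k) - g s))) := by
    intro s
    rw [tandemGen, Finset.mul_sum, ← Finset.sum_neg_distrib]
    refine Finset.sum_congr rfl fun k _ => by ring
  have hsum := (summable_mul_of_bounded hσ (abs_tandemGen_le hμ hl hgb)).hasSum.neg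
  rw [tsum_mul_tandemGen_eq_zero hμ hl hσ hbal hgb, neg_zero,
    hasSum_zero_iff_of_nonneg fun s => by
      rw [hexp]; exact Finset.sum_nonneg fun k _ => hterm s k] at hsum
  have h0 := congrFun hsum s
  simp only [Pi.zero_apply] at h0
  rw [hexp, Finset.sum_eq_zero_iff_of_nonneg fun k _ => hterm s k] at h0
  have h1 := h0 k (Finset.mem_univ k)
  have h2 : g (tandemNext s k) = g s := by
    have := neg_eq_zero.1 h1
    rcases mul_eq_zero.1 this with h | h
    · exact absurd h hk.ne'
    · rcases mul_eq_zero.1 h with h | h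
      · exact absurd h hs
      · linarith
  simp only [hg] at h2
  rcases lt_trichotomy (σ (tandemNext s k)) 0 with h | h | h <;>
    rcases lt_trichotomy (σ s) 0 with h' | h' | h' <;> simp [h, h'] at h2 ⊢ <;> norm_num at h2

/-- Uniqueness of the invariant measure of the tandem queue, for signed measures of mass zero. -/
theorem eq_zero_of_invariant {μ l : ℝ} (hμ : 0 < μ) (hl : 0 < l) {σ : ℕ × ℕ → ℝ}
    (hσ : Summable σ) (hbal : ∀ t, ∑' s, σ s * tandemGen μ l (Pi.single t 1) s = 0)
    (hmass : ∑' s, σ s = 0) (s : ℕ × ℕ) : σ s = 0 := by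
  -- Preparations and then riders lead from any state to `(0, 0)`, preserving the sign. A
  -- preparation raises `r`, hence the induction on `a` with `r` arbitrary. Thus `σ` never changes
  -- sign, and total mass zero forces `σ = 0`.
  have hsign : ∀ (a r : ℕ), σ (a, r) ≠ 0 →
      SignType.sign (σ (0, 0)) = SignType.sign (σ (a, r)) := by
    intro a
    induction a with
    | zero =>
      intro r
      induction r with
      | zero => intro _; rfl
      | succ r ih =>
        intro h
        have := sign_next_eq hμ.le hl.le hσ hbal h (k := Event.rider) (by simp [tandemRate, hl])
        simp only [tandemNext, Nat.add_sub_cancel] at this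
        rw [← this]
        refine ih fun h0 => h ?_
        rw [h0, sign_zero] at this
        exact sign_eq_zero_iff.1 this.symm
    | succ a ih =>
      intro r h
      have := sign_next_eq hμ.le hl.le hσ hbal h (k := Event.prepared) (by simp [tandemRate, hμ])
      simp only [tandemNext, Nat.add_sub_cancel] at this
      rw [← this]
      refine ih _ fun h0 => h ?_
      rw [h0, sign_zero] at this
      exact sign_eq_zero_iff.1 this.symm
  rcases lt_trichotomy (σ (0, 0)) 0 with h0 | h0 | h0
  · have hn : ∀ t, 0 ≤ -σ t := by
      rintro ⟨a, r⟩
      by_contra h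
      have := hsign a r (by intro h'; simp [h'] at h)
      rw [sign_neg h0, sign_pos (by linarith)] at this
      simp at this
    have := hσ.hasSum.neg
    rw [hmass, neg_zero, hasSum_zero_iff_of_nonneg hn] at this
    simpa using congrFun this s
  · by_contra h
    have := hsign s.1 s.2 h
    rw [h0, sign_zero] at this
    exact h (sign_eq_zero_iff.1 this.symm)
  · have hn : ∀ t, 0 ≤ σ t := by
      rintro ⟨a, r⟩
      by_contra h
      have := hsign a r (by intro h'; simp [h'] at h)
      rw [sign_pos h0, sign_neg (by linarith)] at this
      simp at this
    have := hσ.hasSum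
    rw [hmass, hasSum_zero_iff_of_nonneg hn] at this
    simpa using congrFun this s

end

/-! ### The stationary law and the ergodic theorem for a tight path. -/

section

theorem hasSum_geomProd_mul {x y : ℝ} {u v : ℕ → ℝ} {α β : ℝ}
    (hu0 : ∀ n, 0 ≤ u n) (hv0 : ∀ n, 0 ≤ v n) (hx0 : 0 ≤ x) (hx1 : x < 1) (hy0 : 0 ≤ y)
    (hy1 : y < 1)
    (hu : HasSum (fun n => (1 - x) * x ^ n * u n) α)
    (hv : HasSum (fun n => (1 - y) * y ^ n * v n) β) :
    HasSum (fun s : ℕ × ℕ => geomProd x y s * (u s.1 * v s.2)) (α * β) := by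
  have h1x : 0 ≤ 1 - x := by linarith
  have h1y : 0 ≤ 1 - y := by linarith
  have hs := hu.summable.mul_of_nonneg hv.summable
    (fun n => mul_nonneg (mul_nonneg h1x (pow_nonneg hx0 n)) (hu0 n))
    (fun n => mul_nonneg (mul_nonneg h1y (pow_nonneg hy0 n)) (hv0 n))
  have := hu.mul hv hs
  refine this.congr_fun fun s => ?_
  simp only [geomProd]; ring

theorem hasSum_geom_one {x : ℝ} (hx0 : 0 ≤ x) (hx1 : x < 1) :
    HasSum (fun n : ℕ => (1 - x) * x ^ n * 1) 1 := by
  have := (hasSum_geometric_of_lt_one hx0 hx1).mul_left (1 - x)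
  rw [mul_inv_cancel₀ (by linarith)] at this
  simpa using this

/-- Excess of a geometric variable over a level. -/
theorem hasSum_geom_excess {x : ℝ} (hx0 : 0 ≤ x) (hx1 : x < 1) (d : ℕ) :
    HasSum (fun n : ℕ => (1 - x) * x ^ n * ((n - d : ℕ) : ℝ)) (x ^ (d + 1) / (1 - x)) := by
  have h1x : (1 - x) ≠ 0 := by linarith
  have h0 := (hasSum_coe_mul_geometric_of_norm_lt_one (r := x)
    (by rwa [Real.norm_eq_abs, abs_of_nonneg hx0])).mul_left ((1 - x) * x ^ d)
  rw [← hasSum_nat_add_iff' d]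
  have hz : ∑ i ∈ Finset.range d, (1 - x) * x ^ i * ((i - d : ℕ) : ℝ) = 0 := by
    refine Finset.sum_eq_zero fun i hi => ?_
    rw [Nat.sub_eq_zero_of_le (Finset.mem_range.1 hi).le]; simp
  rw [hz, sub_zero]
  convert! h0 using 1
  · funext n
    rw [Nat.add_sub_cancel, pow_add]; ring
  · field_simp
    ring

/-- Shortfall of a geometric variable below a level. -/
theorem hasSum_geom_shortfall {x : ℝ} (hx0 : 0 ≤ x) (hx1 : x < 1) (d : ℕ) :
    HasSum (fun n : ℕ => (1 - x) * x ^ n * ((d - n : ℕ) : ℝ))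
      (d - x / (1 - x) + x ^ (d + 1) / (1 - x)) := by
  -- Uses `(d - n)⁺ = d - n + (n - d)⁺`.
  have h1 := (hasSum_geom_one hx0 hx1).mul_left (d : ℝ)
  have h2 := hasSum_geom_excess hx0 hx1 0
  have h3 := hasSum_geom_excess hx0 hx1 d
  have := (h1.sub h2).add h3
  convert! this using 1
  · funext n
    rcases le_total n d with h | h
    · rw [Nat.sub_eq_zero_of_le h, Nat.cast_sub h]; simp; ring
    · rw [Nat.sub_eq_zero_of_le h, Nat.cast_sub h]; simp; ring
  · simp

theorem hasSum_geom_pos {x : ℝ} (hx0 : 0 < x) (hx1 : x < 1) :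
    HasSum (fun n : ℕ => (1 - x) * x ^ n * (if 0 < n then 1 / x else 0)) 1 := by
  have h0 := hasSum_geom_one hx0.le hx1
  rw [← hasSum_nat_add_iff' 1]
  simp only [Finset.range_one, Finset.sum_singleton, lt_irrefl, if_false, mul_zero, sub_zero]
  refine h0.congr_fun fun n => ?_
  simp only [Nat.succ_pos, if_true, pow_succ]
  field_simp

theorem hasSum_geomProd {x y : ℝ} (hx0 : 0 ≤ x) (hx1 : x < 1) (hy0 : 0 ≤ y) (hy1 : y < 1) :
    HasSum (geomProd x y) 1 := by
  have := hasSum_geomProd_mul (fun _ => zero_le_one) (fun _ => zero_le_one) hx0 hx1 hy0 hy1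
    (hasSum_geom_one hx0 hx1) (hasSum_geom_one hy0 hy1)
  simpa using this

/-- Every kind of transition takes place at rate one in the stationary regime. -/
theorem hasSum_geomProd_rate {μ l : ℝ} (hμ : 1 < μ) (hl : 1 < l) (k : Event) :
    HasSum (fun s => geomProd (1 / μ) (1 / l) s * tandemRate μ l s k) 1 := by
  have hx0 : 0 < 1 / μ := by positivity
  have hx1 : 1 / μ < 1 := by rw [div_lt_one (by linarith)]; exact hμ
  have hy0 : 0 < 1 / l := by positivity
  have hy1 : 1 / l < 1 := by rw [div_lt_one (by linarith)]; exact hl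
  have ux := hasSum_geom_one hx0.le hx1
  have uy := hasSum_geom_one hy0.le hy1
  have px := hasSum_geom_pos hx0 hx1
  have py := hasSum_geom_pos hy0 hy1
  have n1 : ∀ n : ℕ, (0 : ℝ) ≤ (fun _ => 1) n := fun _ => zero_le_one
  rw [one_div_one_div] at px py
  cases k
  · simpa [tandemRate] using hasSum_geomProd_mul n1 n1 hx0.le hx1 hy0.le hy1 ux uy
  · have := hasSum_geomProd_mul (fun n => by positivity) n1 hx0.le hx1 hy0.le hy1 px uy
    simpa [tandemRate] using this
  · have := hasSum_geomProd_mul n1 (fun n => by positivity) hx0.le hx1 hy0.le hy1 ux py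
    simpa [tandemRate] using this

/-- The product of geometric distributions is invariant. -/
theorem tsum_geomProd_mul_tandemGen {μ l : ℝ} (hμ : 1 < μ) (hl : 1 < l) {g : ℕ × ℕ → ℝ} {C : ℝ}
    (hg : ∀ s, |g s| ≤ C) : ∑' s, geomProd (1 / μ) (1 / l) s * tandemGen μ l g s = 0 := by
  have hx0 : 0 < 1 / μ := by positivity
  have hx1 : 1 / μ < 1 := by rw [div_lt_one (by linarith)]; exact hμ
  have hy0 : 0 < 1 / l := by positivity
  have hy1 : 1 / l < 1 := by rw [div_lt_one (by linarith)]; exact hl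
  set π := geomProd (1 / μ) (1 / l) with hπ
  have hπs : Summable π := (hasSum_geomProd hx0.le hx1 hy0.le hy1).summable
  have hC : 0 ≤ C := (abs_nonneg _).trans (hg (0, 0))
  have s0 : Summable fun s => π s * g s := summable_mul_of_bounded hπs hg
  have s1 : Summable fun s : ℕ × ℕ => π s * g (s.1 + 1, s.2) :=
    summable_mul_of_bounded hπs fun s => hg _
  have s2 : Summable fun s : ℕ × ℕ => π s * g (s.1, s.2 + 1) :=
    summable_mul_of_bounded hπs fun s => hg _
  have sk : ∀ k, Summable fun s => π s * (tandemRate μ l s k * (g (tandemNext s k) - g s)) := by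
    intro k
    refine summable_mul_of_bounded hπs (C := (1 + μ + l) * (2 * C)) fun s => ?_
    rw [abs_mul, abs_of_nonneg (tandemRate_nonneg (by linarith) (by linarith) s k)]
    refine mul_le_mul ?_ ?_ (abs_nonneg _) (by linarith)
    · refine le_trans ?_ (tandemTotal_le (by linarith) (by linarith) s)
      exact Finset.single_le_sum (f := tandemRate μ l s)
        (fun k _ => tandemRate_nonneg (by linarith) (by linarith) s k) (Finset.mem_univ k)
    · have := abs_sub (g (tandemNext s k)) (g s)
      linarith [hg (tandemNext s k), hg s]
  have e0 : ∑' s, π s * (tandemRate μ l s Event.order * (g (tandemNext s Event.order) - g s))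
      = ∑' s : ℕ × ℕ, π s * g (s.1 + 1, s.2) - ∑' s, π s * g s := by
    rw [← s1.tsum_sub s0]
    refine tsum_congr fun s => ?_
    simp only [tandemRate, tandemNext]; ring
  -- Since `μ * π (a + 1, r) = π (a, r)`, reindexing turns the preparation term into a difference of
  -- shifted sums. With the analogous identity for riders, the three contributions cancel
  -- cyclically.
  have e1 : ∑' s, π s * (tandemRate μ l s Event.prepared
        * (g (tandemNext s Event.prepared) - g s))
      = ∑' s : ℕ × ℕ, π s * g (s.1, s.2 + 1) - ∑' s : ℕ × ℕ, π s * g (s.1 + 1, s.2) := by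
    rw [← s2.tsum_sub s1]
    have hinj : Function.Injective fun s : ℕ × ℕ => (s.1 + 1, s.2) := by
      rintro ⟨a, b⟩ ⟨c, d⟩ h; simp_all
    rw [← hinj.tsum_eq]
    · refine tsum_congr fun s => ?_
      simp only [tandemRate, tandemNext, hπ, geomProd, Nat.succ_pos, if_true,
        Nat.add_sub_cancel, pow_succ]
      field_simp
    · rintro ⟨a, r⟩ h
      rcases a with _ | a
      · simp [tandemRate] at h
      · exact ⟨(a, r), rfl⟩
  have e2 : ∑' s, π s * (tandemRate μ l s Event.rider
        * (g (tandemNext s Event.rider) - g s))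
      = ∑' s : ℕ × ℕ, π s * g s - ∑' s : ℕ × ℕ, π s * g (s.1, s.2 + 1) := by
    rw [← s0.tsum_sub s2]
    have hinj : Function.Injective fun s : ℕ × ℕ => (s.1, s.2 + 1) := by
      rintro ⟨a, b⟩ ⟨c, d⟩ h; simp_all
    rw [← hinj.tsum_eq]
    · refine tsum_congr fun s => ?_
      simp only [tandemRate, tandemNext, hπ, geomProd, Nat.succ_pos, if_true,
        Nat.add_sub_cancel, pow_succ]
      field_simp
    · rintro ⟨a, r⟩ h
      rcases r with _ | r
      · simp [tandemRate] at h
      · exact ⟨(a, r), rfl⟩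
  simp only [tandemGen, Finset.mul_sum]
  rw [Summable.tsum_finsetSum fun k _ => sk k, sum_event, e0, e1, e2]
  ring

/-- Linear growth is negligible against `β ^ n`; this is the condition that
`exists_ultrafilter_limit` puts on test functions. -/
theorem finite_small_of_linear {β : ℝ} (hβ : 1 < β) {f : ℕ × ℕ → ℝ} {C : ℝ}
    (hf : ∀ s, |f s| ≤ C * (1 + s.1 + s.2)) {ε : ℝ} (hε : 0 < ε) :
    {s : ℕ × ℕ | ε * β ^ (s.1 + s.2) < |f s|}.Finite := by
  have hC : 0 ≤ C := by have := (abs_nonneg _).trans (hf (0, 0)); simpa using this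
  have h1 : Tendsto (fun n : ℕ => (C * (1 + n)) / β ^ n) atTop (𝓝 0) := by
    have a := tendsto_pow_const_div_const_pow_of_one_lt 0 hβ
    have b := tendsto_pow_const_div_const_pow_of_one_lt 1 hβ
    have := (a.add b).const_mul C
    simp only [add_zero, mul_zero] at this
    refine this.congr fun n => ?_
    simp only [pow_zero, pow_one]; ring
  obtain ⟨N, hN⟩ := eventually_atTop.1 (h1.eventually (gt_mem_nhds hε))
  refine Set.Finite.subset ((Set.finite_Iio N).prod (Set.finite_Iio N)) fun s hs => ?_
  have hs' : ε * β ^ (s.1 + s.2) < |f s| := hs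
  have hlt : s.1 + s.2 < N := by
    by_contra h
    have := hN (s.1 + s.2) (not_lt.1 h)
    rw [div_lt_iff₀ (by positivity)] at this
    have h2 := hf s
    push_cast at this
    linarith
  exact ⟨by simp; omega, by simp; omega⟩

/-- Weighted average of a function along the first `m` states of a path. -/
def pathAvg (μ l : ℝ) (y : ℕ → ℕ × ℕ) (m : ℕ) : (ℕ × ℕ → ℝ) →ₗ[ℝ] ℝ where
  toFun f := (∑ i ∈ Finset.range m, f (y i) / tandemTotal μ l (y i)) / m
  map_add' f g := by
    simp only [Pi.add_apply, add_div, Finset.sum_add_distrib]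
  map_smul' c f := by
    simp only [Pi.smul_apply, smul_eq_mul, mul_div_assoc, ← Finset.mul_sum, RingHom.id_apply]

theorem pathAvg_apply (μ l : ℝ) (y : ℕ → ℕ × ℕ) (m : ℕ) (f : ℕ × ℕ → ℝ) :
    pathAvg μ l y m f = (∑ i ∈ Finset.range m, f (y i) / tandemTotal μ l (y i)) / m := rfl

/-- Reciprocal of the stationary mean of the total rate. -/
def meanHold (μ l : ℝ) : ℝ := 1 / ∑' s, geomProd (1 / μ) (1 / l) s * tandemTotal μ l s

/-- Ergodic theorem for a tight path whose averages annihilate the generator. -/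
theorem tendsto_pathAvg {μ l : ℝ} (hμ : 1 < μ) (hl : 1 < l) {y : ℕ → ℕ × ℕ} {u : ℕ → ℕ}
    (hu : Tendsto u atTop atTop) {β K : ℝ} (hβ : 1 < β)
    (hK : ∀ n, pathAvg μ l y (u n) (fun s => β ^ (s.1 + s.2)) ≤ K)
    (hgen : ∀ t, Tendsto (fun n => pathAvg μ l y (u n) (tandemGen μ l (Pi.single t 1))) atTop
      (𝓝 0)) {f : ℕ × ℕ → ℝ} {C : ℝ} (hf : ∀ s, |f s| ≤ C * (1 + s.1 + s.2)) {c : ℝ}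
    (hc : HasSum (fun s => geomProd (1 / μ) (1 / l) s * f s) c) :
    Tendsto (fun n => pathAvg μ l y (u n) f) atTop (𝓝 (meanHold μ l * c)) := by
  have hx0 : 0 < 1 / μ := by positivity
  have hx1 : 1 / μ < 1 := by rw [div_lt_one (by linarith)]; exact hμ
  have hy0 : 0 < 1 / l := by positivity
  have hy1 : 1 / l < 1 := by rw [div_lt_one (by linarith)]; exact hl
  have hμ0 : 0 ≤ μ := by linarith
  have hl0 : 0 ≤ l := by linarith
  have hν : ∀ s, 0 < tandemTotal μ l s := fun s => zero_lt_one.trans_le (one_le_tandemTotal hμ0 hl0 s)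
  set π := geomProd (1 / μ) (1 / l) with hπ
  have hπ1 : HasSum π 1 := hasSum_geomProd hx0.le hx1 hy0.le hy1
  have bdd : ∀ {g : ℕ × ℕ → ℝ} {D : ℝ}, (∀ s, |g s| ≤ D) →
      ∀ s, |g s| ≤ D * (1 + (s : ℕ × ℕ).1 + s.2) := by
    intro g D hg s
    have hD : 0 ≤ D := (abs_nonneg _).trans (hg s)
    have h1 : (0 : ℝ) ≤ (s.1 : ℝ) + s.2 := by positivity
    nlinarith [hg s, mul_nonneg hD h1]
  -- It suffices to find the same limit along every ultrafilter; no convergent subsequence has to be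
  -- extracted.
  rw [tendsto_iff_ultrafilter]
  intro U hU
  obtain ⟨w, _, hlim⟩ := exists_ultrafilter_limit (fun n => pathAvg μ l y (u n))
    (fun n f hf => div_nonneg (Finset.sum_nonneg fun i _ => div_nonneg (hf _) (hν _).le)
      (Nat.cast_nonneg _))
    (W := fun s => β ^ (s.1 + s.2)) (fun s => one_le_pow₀ hβ.le) hK U
  have hlim' : ∀ (g : ℕ × ℕ → ℝ) (D : ℝ), (∀ s, |g s| ≤ D * (1 + s.1 + s.2)) →
      Summable (fun s => w s * g s) ∧
        Tendsto (fun n => pathAvg μ l y (u n) g) U (𝓝 (∑' s, w s * g s)) := fun g D hg =>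
    hlim g fun ε hε => finite_small_of_linear hβ hg hε
  have hls : Summable w := by
    have := (hlim' (fun _ => 1) 1 (bdd fun s => by simp)).1
    simpa using this
  have hsingle : ∀ t s : ℕ × ℕ, |(Pi.single t 1 : ℕ × ℕ → ℝ) s| ≤ 1 := by
    intro t s
    rw [Pi.single_apply]; split_ifs <;> simp
  have hbal : ∀ t, ∑' s, w s * tandemGen μ l (Pi.single t 1) s = 0 := fun t =>
    tendsto_nhds_unique (hlim' _ _ (bdd (abs_tandemGen_le hμ0 hl0 (hsingle t)))).2
      ((hgen t).mono_left hU)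
  set m := ∑' s, w s with hm
  -- The signed weight `w - m π` is invariant with total mass zero.
  have heq : ∀ s, w s = m * π s := by
    intro s
    have := eq_zero_of_invariant (σ := fun s => w s - m * π s) (by linarith : 0 < μ)
      (by linarith : 0 < l) (hls.sub (hπ1.summable.mul_left m)) (fun t => ?_) ?_ s
    · linarith
    · have b := abs_tandemGen_le hμ0 hl0 (hsingle t)
      have h1 := summable_mul_of_bounded hls b
      have h2 := summable_mul_of_bounded hπ1.summable b
      have h3 : ∀ s, (w s - m * π s) * tandemGen μ l (Pi.single t 1) s
          = w s * tandemGen μ l (Pi.single t 1) s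
            - m * (π s * tandemGen μ l (Pi.single t 1) s) := fun s => by ring
      simp_rw [h3]
      rw [h1.tsum_sub (h2.mul_left m), tsum_mul_left, hbal,
        tsum_geomProd_mul_tandemGen hμ hl (hsingle t)]
      ring
    · rw [hls.tsum_sub (hπ1.summable.mul_left m), tsum_mul_left, hπ1.tsum_eq]
      ring
  have hνb : ∀ s, |tandemTotal μ l s| ≤ 1 + μ + l := fun s => by
    rw [abs_of_pos (hν s)]; exact tandemTotal_le hμ0 hl0 s
  -- Path averages weigh states by mean holding time, so `w` need not have mass one. The average of
  -- the total rate is exactly one, and this determines `m`.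
  have hν1 : ∑' s, w s * tandemTotal μ l s = 1 := by
    refine tendsto_nhds_unique (hlim' _ _ (bdd hνb)).2 (tendsto_const_nhds.congr' ?_)
    filter_upwards [hU (hu.eventually (eventually_gt_atTop 0))] with n hn
    rw [pathAvg_apply, Finset.sum_congr rfl fun i _ => div_self (hν _).ne']
    have : (u n : ℝ) ≠ 0 := by exact_mod_cast (Nat.pos_iff_ne_zero.1 hn)
    simp [this]
  have hmc : m = meanHold μ l := by
    simp_rw [heq, mul_assoc] at hν1
    rw [tsum_mul_left] at hν1
    rw [meanHold]
    exact eq_one_div_of_mul_eq_one_left hν1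
  have := (hlim' f C hf).2
  simp_rw [heq, mul_assoc] at this
  rwa [tsum_mul_left, hc.tsum_eq, hmc] at this

theorem meanHold_pos {μ l : ℝ} (hμ : 1 < μ) (hl : 1 < l) : 0 < meanHold μ l := by
  have hx0 : 0 < 1 / μ := by positivity
  have hy0 : 0 < 1 / l := by positivity
  have h := hasSum_sum (s := Finset.univ) fun k _ => hasSum_geomProd_rate hμ hl k
  simp_rw [← Finset.mul_sum] at h
  have h2 : ∑' s, geomProd (1 / μ) (1 / l) s * tandemTotal μ l s = ∑ _k : Event, (1 : ℝ) :=
    h.tsum_eq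
  rw [meanHold, h2, sum_event]
  norm_num

end

/-! ### Lyapunov drift and the almost sure ergodic theorem. -/

section

/-- Transition probabilities of the jump chain of the tandem queue. -/
def tandemProb (μ l : ℝ) (s : ℕ × ℕ) (k : Event) : ℝ := tandemRate μ l s k / tandemTotal μ l s

theorem tandemTotal_pos {μ l : ℝ} (hμ : 0 ≤ μ) (hl : 0 ≤ l) (s : ℕ × ℕ) :
    0 < tandemTotal μ l s := zero_lt_one.trans_le (one_le_tandemTotal hμ hl s)

theorem tandemProb_nonneg {μ l : ℝ} (hμ : 0 ≤ μ) (hl : 0 ≤ l) (s : ℕ × ℕ) (k : Event) :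
    0 ≤ tandemProb μ l s k :=
  div_nonneg (tandemRate_nonneg hμ hl s k) (tandemTotal_pos hμ hl s).le

theorem sum_tandemProb {μ l : ℝ} (hμ : 0 ≤ μ) (hl : 0 ≤ l) (s : ℕ × ℕ) :
    ∑ k, tandemProb μ l s k = 1 := by
  simp only [tandemProb]
  rw [← Finset.sum_div]
  exact div_self (tandemTotal_pos hμ hl s).ne'

theorem sum_tandemProb_mul_next {μ l : ℝ} (hμ : 0 ≤ μ) (hl : 0 ≤ l) (g : ℕ × ℕ → ℝ) (s : ℕ × ℕ) :
    ∑ k, tandemProb μ l s k * g (tandemNext s k)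
      = g s + tandemGen μ l g s / tandemTotal μ l s := by
  have h1 : tandemGen μ l g s / tandemTotal μ l s
      = ∑ k, tandemProb μ l s k * g (tandemNext s k) - (∑ k, tandemProb μ l s k) * g s := by
    rw [tandemGen, Finset.sum_div, Finset.sum_mul, ← Finset.sum_sub_distrib]
    refine Finset.sum_congr rfl fun k _ => ?_
    rw [tandemProb]; ring
  rw [h1, sum_tandemProb hμ hl]; ring

/-- Exponential Lyapunov function of the tandem queue. -/
def lyapunov (γ C : ℝ) (s : ℕ × ℕ) : ℝ := γ ^ (s.1 + s.2) + C * γ ^ s.1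

/-- When `r > 0`, orders and riders make `γ ^ (a + r)` decay at rate `c₁`, and preparations leave it
unchanged. At `r = 0` it grows, by a multiple of `γ ^ a`; the second term `C * γ ^ a`, which decays
at rate `c₂` while the first server is busy, pays for that. -/
theorem exists_drift {μ l γ : ℝ} (hγ : 1 < γ) (hγμ : γ < μ) (hγl : γ < l) :
    ∃ C δ b : ℝ, 0 ≤ C ∧ 0 < δ ∧ δ ≤ 1 ∧ 0 ≤ b ∧
      ∀ s, tandemGen μ l (lyapunov γ C) s ≤ b - δ * lyapunov γ C s := by
  have hγ0 : 0 < γ := by linarith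
  set c₁ := (γ - 1) * (l / γ - 1) with hc₁
  set c₂ := (γ - 1) * (μ / γ - 1) with hc₂
  have h1 : 0 < c₁ := mul_pos (by linarith) (by rw [sub_pos, lt_div_iff₀ hγ0]; linarith)
  have h2 : 0 < c₂ := mul_pos (by linarith) (by rw [sub_pos, lt_div_iff₀ hγ0]; linarith)
  -- Chosen so that `C * c₂` covers the boundary cost `c₁ + (γ - 1)` and leaves a surplus `c₂`,
  -- which bounds `δ * C`.
  set C := (c₁ + (γ - 1)) / c₂ + 1 with hC
  have hC1 : 1 ≤ C := by
    have : 0 ≤ (c₁ + (γ - 1)) / c₂ := div_nonneg (by linarith) h2.le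
    linarith
  have hCc : C * c₂ = c₁ + (γ - 1) + c₂ := by rw [hC]; field_simp
  set δ := min 1 (min c₁ (c₂ / C)) with hδ
  have hδ0 : 0 < δ := lt_min one_pos (lt_min h1 (div_pos h2 (by linarith)))
  have hδ1 : δ ≤ c₁ := (min_le_right _ _).trans (min_le_left _ _)
  have hδ2 : δ * C ≤ c₂ := by
    rw [← le_div_iff₀ (by linarith)]
    exact (min_le_right _ _).trans (min_le_right _ _)
  set b := C * (c₂ + (γ - 1)) with hb
  have hb0 : 0 ≤ b := mul_nonneg (by linarith) (by linarith)
  refine ⟨C, δ, b, by linarith, hδ0, min_le_left _ _, hb0, ?_⟩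
  rintro ⟨a, r⟩
  have hA : 0 < γ ^ a := pow_pos hγ0 a
  have hN : 0 < γ ^ (a + r) := pow_pos hγ0 _
  have hfirst : (γ ^ (a + 1 + r) - γ ^ (a + r))
      + (if 0 < r then l else 0) * (γ ^ (a + (r - 1)) - γ ^ (a + r))
      ≤ -c₁ * γ ^ (a + r) + (c₁ + (γ - 1)) * γ ^ a := by
    rcases r with _ | r
    · simp only [lt_irrefl, if_false, add_zero, zero_mul, pow_succ]
      linarith
    · have e : -c₁ * γ ^ (a + (r + 1)) = (γ ^ (a + 1 + (r + 1)) - γ ^ (a + (r + 1)))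
          + l * (γ ^ (a + r) - γ ^ (a + (r + 1))) := by
        rw [hc₁]
        simp only [pow_add, pow_one]
        field_simp
        ring
      simp only [Nat.succ_pos, if_true, Nat.add_sub_cancel]
      rw [← e]
      have : 0 ≤ (c₁ + (γ - 1)) * γ ^ a := mul_nonneg (by linarith) hA.le
      linarith
  have hsecond : (γ ^ (a + 1) - γ ^ a) + (if 0 < a then μ else 0) * (γ ^ (a - 1) - γ ^ a)
      ≤ -c₂ * γ ^ a + (c₂ + (γ - 1)) := by
    rcases a with _ | a
    · simp only [lt_irrefl, if_false, zero_mul, zero_add, pow_one, pow_zero]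
      linarith
    · have e : -c₂ * γ ^ (a + 1) = (γ ^ (a + 1 + 1) - γ ^ (a + 1))
          + μ * (γ ^ a - γ ^ (a + 1)) := by
        rw [hc₂]
        simp only [pow_add, pow_one]
        field_simp
        ring
      simp only [Nat.succ_pos, if_true, Nat.add_sub_cancel]
      rw [← e]
      linarith
  have hgen : tandemGen μ l (lyapunov γ C) (a, r)
      = ((γ ^ (a + 1 + r) - γ ^ (a + r))
        + (if 0 < r then l else 0) * (γ ^ (a + (r - 1)) - γ ^ (a + r)))
      + C * ((γ ^ (a + 1) - γ ^ a) + (if 0 < a then μ else 0) * (γ ^ (a - 1) - γ ^ a)) := by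
    rw [tandemGen, sum_event]
    simp only [tandemRate, tandemNext, lyapunov]
    rcases a with _ | a
    · simp only [lt_irrefl, if_false]; ring
    · simp only [Nat.succ_pos, if_true, Nat.add_sub_cancel, show a + (r + 1) = a + 1 + r by omega]
      ring
  rw [hgen]
  have h3 := mul_le_mul_of_nonneg_left hsecond (by linarith : 0 ≤ C)
  have h4 : C * (-c₂ * γ ^ a + (c₂ + (γ - 1))) = -(c₁ + (γ - 1) + c₂) * γ ^ a + b := by
    rw [← hCc, hb]; ring
  have h5 := mul_le_mul_of_nonneg_right hδ1 hN.le
  have h6 := mul_le_mul_of_nonneg_right hδ2 hA.le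
  simp only [lyapunov]
  linarith

variable {Ω : Type*} [MeasurableSpace Ω] {P : Measure Ω} [IsProbabilityMeasure P]
  {μ l : ℝ} {s₀ : ℕ × ℕ} {e : ℕ → Ω → Event}

/-- Exponential moments of the tandem queue are bounded. -/
theorem exists_moment_bound (hL : HasChainLaw (tandemProb μ l) tandemNext s₀ e P) {γ : ℝ}
    (hγ : 1 < γ) (hγμ : γ < μ) (hγl : γ < l) :
    ∃ K : ℝ, ∀ n, ∫ ω, γ ^ ((chainPath tandemNext s₀ (fun i => e i ω) n).1
      + (chainPath tandemNext s₀ (fun i => e i ω) n).2) ∂P ≤ K := by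
  have hμ0 : 0 ≤ μ := by linarith
  have hl0 : 0 ≤ l := by linarith
  have hγ0 : 0 ≤ γ := by linarith
  obtain ⟨C, δ, b, hC, hδ, hδ1, hb, hdrift⟩ := exists_drift hγ hγμ hγl
  have hV0 : ∀ s, 0 ≤ lyapunov γ C s := fun s => by rw [lyapunov]; positivity
  set B := 1 + μ + l
  have hB : 1 ≤ B := by simp only [B]; linarith
  -- The jump chain divides the generator by the total rate, which is at most `B`; hence the smaller
  -- contraction rate.
  set δ' := δ / B
  have hδ'0 : 0 < δ' := div_pos hδ (by linarith)
  have hδ'1 : δ' ≤ 1 := by rw [div_le_one (by linarith)]; linarith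
  have hstep : ∀ s, ∑ k, tandemProb μ l s k * lyapunov γ C (tandemNext s k)
      ≤ (1 - δ') * lyapunov γ C s + b := by
    intro s
    rw [sum_tandemProb_mul_next hμ0 hl0]
    have ht := one_le_tandemTotal hμ0 hl0 s
    have hν := tandemTotal_pos hμ0 hl0 s
    have h1 : tandemGen μ l (lyapunov γ C) s / tandemTotal μ l s
        ≤ (b - δ * lyapunov γ C s) / tandemTotal μ l s :=
      div_le_div_of_nonneg_right (hdrift s) hν.le
    have h2 : b / tandemTotal μ l s ≤ b := div_le_self hb ht
    have h3 : δ' * lyapunov γ C s ≤ δ * lyapunov γ C s / tandemTotal μ l s := by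
      rw [div_mul_eq_mul_div]
      exact div_le_div_of_nonneg_left (mul_nonneg hδ.le (hV0 s)) hν (tandemTotal_le hμ0 hl0 s)
    rw [sub_div] at h1
    linarith
  set K := lyapunov γ C s₀ + b / δ'
  have hVi : ∀ n, Integrable (fun ω => lyapunov γ C (chainPath tandemNext s₀ (fun i => e i ω) n)) P :=
    fun n => (dependsOnFirst_state tandemNext s₀ (lyapunov γ C) n).integrable hL.measurable_event
  have hmom : ∀ n, ∫ ω, lyapunov γ C (chainPath tandemNext s₀ (fun i => e i ω) n) ∂P ≤ K := by
    intro n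
    induction n with
    | zero =>
      simp only [chainPath, integral_const, probReal_univ, one_smul, K]
      have : 0 ≤ b / δ' := div_nonneg hb hδ'0.le
      linarith
    | succ n ih =>
      have h1 := hL.integral_mul_step (tandemProb_nonneg hμ0 hl0) (n := n) (g := fun _ => 1)
        (fun _ _ _ => rfl) (fun s k => lyapunov γ C (tandemNext s k))
      simp only [one_mul] at h1
      have h2 : ∫ ω, lyapunov γ C (chainPath tandemNext s₀ (fun i => e i ω) (n + 1)) ∂P
          ≤ ∫ ω, ((1 - δ') * lyapunov γ C (chainPath tandemNext s₀ (fun i => e i ω) n) + b) ∂P := by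
        simp only [chainPath]
        rw [h1]
        refine integral_mono ?_ (((hVi n).const_mul _).add (integrable_const _)) fun ω => hstep _
        exact (dependsOnFirst_state tandemNext s₀ (fun s => ∑ k, tandemProb μ l s k *
          lyapunov γ C (tandemNext s k)) n).integrable hL.measurable_event
      rw [integral_add ((hVi n).const_mul _) (integrable_const _), integral_const_mul] at h2
      simp only [integral_const, probReal_univ, one_smul] at h2
      have h3 := mul_le_mul_of_nonneg_left ih (by linarith : 0 ≤ 1 - δ')
      have h4 : δ' * K = δ' * lyapunov γ C s₀ + b := by simp only [K]; field_simp
      have h5 := mul_nonneg hδ'0.le (hV0 s₀)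
      linarith
  refine ⟨K, fun n => le_trans (integral_mono ?_ (hVi n) fun ω => ?_) (hmom n)⟩
  · exact (dependsOnFirst_state tandemNext s₀ (fun s => γ ^ (s.1 + s.2)) n).integrable
      hL.measurable_event
  · simp only [lyapunov]
    have : 0 ≤ C * γ ^ (chainPath tandemNext s₀ (fun i => e i ω) n).1 := by positivity
    linarith

/-- Path averages of the generator are telescoping sums minus martingales. -/
theorem sum_tandemGen_path (hμ : 0 ≤ μ) (hl : 0 ≤ l) (s₀ : ℕ × ℕ) (a : ℕ → Event)
    (g : ℕ × ℕ → ℝ) (m : ℕ) :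
    ∑ i ∈ Finset.range m, tandemGen μ l g (chainPath tandemNext s₀ a i)
        / tandemTotal μ l (chainPath tandemNext s₀ a i)
      = g (chainPath tandemNext s₀ a m) - g s₀
        - ∑ i ∈ Finset.range m, (g (tandemNext (chainPath tandemNext s₀ a i) (a i))
          - ∑ k, tandemProb μ l (chainPath tandemNext s₀ a i) k
            * g (tandemNext (chainPath tandemNext s₀ a i) k)) := by
  simp_rw [sum_tandemProb_mul_next hμ hl]
  have h := Finset.sum_range_sub (fun i => g (chainPath tandemNext s₀ a i)) m
  simp only [chainPath] at h
  rw [← h, ← Finset.sum_sub_distrib]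
  refine Finset.sum_congr rfl fun i _ => by ring

/-- The sum is a bounded boundary term minus a martingale with bounded increments, and both vanish
after division by `n ^ 2`. -/
theorem ae_tendsto_pathAvg_gen (hL : HasChainLaw (tandemProb μ l) tandemNext s₀ e P)
    (hμ : 0 ≤ μ) (hl : 0 ≤ l) {g : ℕ × ℕ → ℝ} {C : ℝ} (hg : ∀ s, |g s| ≤ C) :
    ∀ᵐ ω ∂P, Tendsto (fun n : ℕ => pathAvg μ l (chainPath tandemNext s₀ fun i => e i ω) (n ^ 2)
      (tandemGen μ l g)) atTop (𝓝 0) := by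
  have h := hL.tendsto_avg_martingale (tandemProb_nonneg hμ hl) (sum_tandemProb hμ hl)
    (fun s k => g (tandemNext s k)) (K := C ^ 2) (fun n => by
      refine (integral_mono (((dependsOnFirst_step tandemNext s₀
        (fun s k => g (tandemNext s k) ^ 2) n).integrable hL.measurable_event))
        (integrable_const (C ^ 2)) fun ω => ?_).trans (by simp)
      exact sq_le_sq' (abs_le.1 (hg _)).1 (abs_le.1 (hg _)).2)
  filter_upwards [h] with ω hω
  have hb : Tendsto (fun n : ℕ => (g (chainPath tandemNext s₀ (fun i => e i ω) (n ^ 2)) - g s₀)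
      / ((n ^ 2 : ℕ) : ℝ)) atTop (𝓝 0) := by
    have h2 : Tendsto (fun n : ℕ => ((n ^ 2 : ℕ) : ℝ)) atTop atTop :=
      tendsto_natCast_atTop_atTop.comp (tendsto_pow_atTop two_ne_zero)
    refine squeeze_zero_norm (fun n => ?_) (h2.const_div_atTop (2 * C))
    rw [Real.norm_eq_abs, abs_div, Nat.abs_cast]
    refine div_le_div_of_nonneg_right ?_ (Nat.cast_nonneg _)
    refine (abs_sub _ _).trans ?_
    linarith [hg (chainPath tandemNext s₀ (fun i => e i ω) (n ^ 2)), hg s₀]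
  have := hb.sub hω
  rw [sub_zero] at this
  refine this.congr fun n => ?_
  rw [pathAvg_apply, sum_tandemGen_path hμ hl, ← sub_div]

/-- Pathwise tightness: the drift inequality is summed along the path and the terminal Lyapunov
value discarded. The martingale part needs second moments of `β ^ (a + r)`, which is why `β ^ 2`,
and not just `β`, must lie below both service rates. -/
theorem ae_exists_pathAvg_le (hL : HasChainLaw (tandemProb μ l) tandemNext s₀ e P) {β : ℝ}
    (hβ : 1 < β) (hβμ : β ^ 2 < μ) (hβl : β ^ 2 < l) :
    ∀ᵐ ω ∂P, ∃ K : ℝ, ∀ n : ℕ, pathAvg μ l (chainPath tandemNext s₀ fun i => e i ω) (n ^ 2)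
      (fun s => β ^ (s.1 + s.2)) ≤ K := by
  have hβ2 : β < β ^ 2 := by nlinarith
  have hμ0 : 0 ≤ μ := by linarith
  have hl0 : 0 ≤ l := by linarith
  have hβ0 : 0 ≤ β := by linarith
  obtain ⟨C, δ, b, hC, hδ, hδ1, hb, hdrift⟩ := exists_drift hβ (hβ2.trans hβμ) (hβ2.trans hβl)
  obtain ⟨K, hK⟩ := exists_moment_bound hL (by linarith) hβμ hβl
  have hVW : ∀ s, lyapunov β C s ^ 2 ≤ (1 + C) ^ 2 * (β ^ 2) ^ (s.1 + s.2) := by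
    intro s
    have h1 : lyapunov β C s ≤ (1 + C) * β ^ (s.1 + s.2) := by
      have := mul_le_mul_of_nonneg_left
        (pow_le_pow_right₀ hβ.le (Nat.le_add_right s.1 s.2)) hC
      rw [lyapunov]; linarith
    have h0 : 0 ≤ lyapunov β C s := by rw [lyapunov]; positivity
    calc _ ≤ ((1 + C) * β ^ (s.1 + s.2)) ^ 2 := pow_le_pow_left₀ h0 h1 2
      _ = _ := by rw [mul_pow, ← pow_mul, ← pow_mul, mul_comm 2]
  have h := hL.tendsto_avg_martingale (tandemProb_nonneg hμ0 hl0) (sum_tandemProb hμ0 hl0)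
    (fun s k => lyapunov β C (tandemNext s k)) (K := (1 + C) ^ 2 * K) (fun n => by
      refine (integral_mono (((dependsOnFirst_state tandemNext s₀
        (fun s => lyapunov β C s ^ 2) (n + 1)).integrable hL.measurable_event))
        (((dependsOnFirst_state tandemNext s₀
        (fun s => (β ^ 2) ^ (s.1 + s.2)) (n + 1)).integrable hL.measurable_event).const_mul
          ((1 + C) ^ 2)) fun ω => hVW _).trans ?_
      rw [integral_const_mul]
      exact mul_le_mul_of_nonneg_left (hK (n + 1)) (by positivity))
  filter_upwards [h] with ω hω
  -- Convergence of the martingale averages is used only through their boundedness.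
  obtain ⟨M, hM⟩ := hω.bddAbove_range
  refine ⟨(b + lyapunov β C s₀ + M) / δ, fun n => ?_⟩
  rw [le_div_iff₀ hδ, mul_comm]
  set y := chainPath tandemNext s₀ fun i => e i ω with hy
  have hMn := hM ⟨n, rfl⟩
  simp only at hMn
  set R := ∑ i ∈ Finset.range (n ^ 2), (lyapunov β C (tandemNext (y i) (e i ω))
    - ∑ k, tandemProb μ l (y i) k * lyapunov β C (tandemNext (y i) k)) with hR
  have e1 := sum_tandemGen_path hμ0 hl0 s₀ (fun i => e i ω) (lyapunov β C) (n ^ 2)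
  rw [← hy, ← hR] at e1
  have hV0 : ∀ s, 0 ≤ lyapunov β C s := fun s => by rw [lyapunov]; positivity
  have e2 : ∑ i ∈ Finset.range (n ^ 2), tandemGen μ l (lyapunov β C) (y i) / tandemTotal μ l (y i)
      ≤ ((n ^ 2 : ℕ) : ℝ) * b
        - δ * ∑ i ∈ Finset.range (n ^ 2), β ^ ((y i).1 + (y i).2) / tandemTotal μ l (y i) := by
    rw [Finset.mul_sum, ← nsmul_eq_mul, ← Finset.card_range (n ^ 2), ← Finset.sum_const,
      Finset.card_range, ← Finset.sum_sub_distrib]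
    refine Finset.sum_le_sum fun i _ => ?_
    have ht := one_le_tandemTotal hμ0 hl0 (y i)
    have hν := tandemTotal_pos hμ0 hl0 (y i)
    have h1 : tandemGen μ l (lyapunov β C) (y i) / tandemTotal μ l (y i)
        ≤ (b - δ * lyapunov β C (y i)) / tandemTotal μ l (y i) :=
      div_le_div_of_nonneg_right (hdrift _) hν.le
    have h2 : b / tandemTotal μ l (y i) ≤ b := div_le_self hb ht
    have h3 : δ * (β ^ ((y i).1 + (y i).2) / tandemTotal μ l (y i))
        ≤ δ * lyapunov β C (y i) / tandemTotal μ l (y i) := by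
      rw [← mul_div_assoc]
      refine div_le_div_of_nonneg_right (mul_le_mul_of_nonneg_left ?_ hδ.le) hν.le
      have : 0 ≤ C * β ^ (y i).1 := by positivity
      rw [lyapunov]; linarith
    rw [sub_div] at h1
    linarith
  rcases Nat.eq_zero_or_pos n with rfl | hn
  · simp only [pathAvg_apply]
    have : 0 ≤ M := by simpa using hMn
    simp only [ne_eq, OfNat.ofNat_ne_zero, not_false_eq_true, zero_pow, Nat.cast_zero, div_zero,
      mul_zero]
    linarith [hV0 s₀]
  · have hn2 : (1 : ℝ) ≤ ((n ^ 2 : ℕ) : ℝ) := by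
      exact_mod_cast Nat.one_le_pow 2 n hn
    have hn0 : (0 : ℝ) < ((n ^ 2 : ℕ) : ℝ) := by linarith
    rw [div_le_iff₀ hn0] at hMn
    rw [pathAvg_apply, ← mul_div_assoc, div_le_iff₀ hn0]
    have h6 : lyapunov β C s₀ * 1 ≤ lyapunov β C s₀ * ((n ^ 2 : ℕ) : ℝ) :=
      mul_le_mul_of_nonneg_left hn2 (hV0 _)
    have h7 := hV0 (y (n ^ 2))
    have h8 : (b + lyapunov β C s₀ + M) * ((n ^ 2 : ℕ) : ℝ) = ((n ^ 2 : ℕ) : ℝ) * b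
      + lyapunov β C s₀ * ((n ^ 2 : ℕ) : ℝ) + M * ((n ^ 2 : ℕ) : ℝ) := by ring
    rw [h8]
    linarith

theorem exists_tandem_base (hμ : 1 < μ) (hl : 1 < l) :
    ∃ β : ℝ, 1 < β ∧ β ^ 2 < μ ∧ β ^ 2 < l := by
  set m := min μ l
  have hm : 1 < m := lt_min hμ hl
  have h : (1 : ℝ) < √m := by rw [Real.lt_sqrt zero_le_one]; simpa using hm
  obtain ⟨β, h1, h2⟩ := exists_between h
  have h3 : β ^ 2 < m := by
    rw [← Real.lt_sqrt (by linarith)]; exact h2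
  exact ⟨β, h1, h3.trans_le (min_le_left _ _), h3.trans_le (min_le_right _ _)⟩

/-- Ergodic theorem for the jump chain of the tandem queue, along the squares. -/
theorem ae_tendsto_pathAvg (hL : HasChainLaw (tandemProb μ l) tandemNext s₀ e P)
    (hμ : 1 < μ) (hl : 1 < l) :
    ∀ᵐ ω ∂P, ∀ (f : ℕ × ℕ → ℝ) (C c : ℝ), (∀ s, |f s| ≤ C * (1 + s.1 + s.2)) →
      HasSum (fun s => geomProd (1 / μ) (1 / l) s * f s) c →
      Tendsto (fun n : ℕ => pathAvg μ l (chainPath tandemNext s₀ fun i => e i ω) (n ^ 2) f) atTop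
        (𝓝 (meanHold μ l * c)) := by
  obtain ⟨β, hβ, hβμ, hβl⟩ := exists_tandem_base hμ hl
  have hgen := ae_all_iff.2 fun t : ℕ × ℕ => ae_tendsto_pathAvg_gen hL (by linarith) (by linarith)
    (g := Pi.single t 1) (C := 1) (fun s => by rw [Pi.single_apply]; split_ifs <;> simp)
  filter_upwards [hgen, ae_exists_pathAvg_le hL hβ hβμ hβl] with ω h1 ⟨K, hK⟩ f C c hf hc
  exact tendsto_pathAvg hμ hl (u := fun n => n ^ 2) (tendsto_pow_atTop two_ne_zero) hβ hK h1 hf hc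

/-- Consecutive squares have ratio tending to one, so a monotone sequence is squeezed between its
values at them. -/
theorem tendsto_div_of_tendsto_div_sq {u : ℕ → ℝ} {c : ℝ} (hu : Monotone u)
    (h : Tendsto (fun n : ℕ => u (n ^ 2) / ((n ^ 2 : ℕ) : ℝ)) atTop (𝓝 c)) :
    Tendsto (fun n : ℕ => u n / n) atTop (𝓝 c) := by
  refine tendsto_div_of_monotone_of_exists_subseq_tendsto_div u c hu fun a ha =>
    ⟨fun n => n ^ 2, ?_, tendsto_pow_atTop two_ne_zero, h⟩
  have h1 : Tendsto (fun n : ℕ => (1 + 1 / (n : ℝ)) ^ 2) atTop (𝓝 ((1 + 0) ^ 2)) :=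
    (tendsto_one_div_atTop_nhds_zero_nat.const_add 1).pow 2
  filter_upwards [h1.eventually_lt_const (u := a) (by simpa using ha),
    eventually_gt_atTop 0] with n hn hn0
  have : (0 : ℝ) < n := by exact_mod_cast hn0
  have e : (((n + 1) ^ 2 : ℕ) : ℝ) = (1 + 1 / (n : ℝ)) ^ 2 * ((n ^ 2 : ℕ) : ℝ) := by
    push_cast; field_simp
  rw [e]
  exact mul_le_mul_of_nonneg_right hn.le (Nat.cast_nonneg _)

/-- Frequency of the transitions of each kind. -/
theorem ae_tendsto_count (hL : HasChainLaw (tandemProb μ l) tandemNext s₀ e P)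
    (hμ : 1 < μ) (hl : 1 < l) (k : Event) :
    ∀ᵐ ω ∂P, Tendsto (fun m : ℕ => (Nat.count (fun n => e n ω = k) m : ℝ) / m) atTop
      (𝓝 (meanHold μ l)) := by
  have hμ0 : 0 ≤ μ := by linarith
  have hl0 : 0 ≤ l := by linarith
  -- The indicator of kind `k` has conditional mean `tandemRate / tandemTotal`, so its compensator
  -- is the path average of a rate with stationary mean one.
  have h := hL.tendsto_avg_martingale (tandemProb_nonneg hμ0 hl0) (sum_tandemProb hμ0 hl0)
    (fun _ k' => if k' = k then 1 else 0) (K := 1) (fun n => by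
      refine (integral_mono (((dependsOnFirst_step tandemNext s₀
        (fun _ k' => (if k' = k then (1 : ℝ) else 0) ^ 2) n).integrable hL.measurable_event))
        (integrable_const 1) fun ω => ?_).trans (by simp)
      simp only; split_ifs <;> simp)
  filter_upwards [h, ae_tendsto_pathAvg hL hμ hl] with ω h1 h2
  have h3 := h2 (fun s => tandemRate μ l s k) (1 + μ + l) 1 (fun s => by
    rw [abs_of_nonneg (tandemRate_nonneg hμ0 hl0 s k)]
    have := (Finset.single_le_sum (f := tandemRate μ l s)
        (fun k _ => tandemRate_nonneg hμ0 hl0 s k) (Finset.mem_univ k)).trans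
        (tandemTotal_le hμ0 hl0 s)
    have h4 : (0 : ℝ) ≤ (s.1 : ℝ) + s.2 := by positivity
    have h5 : 0 ≤ (1 + μ + l) * ((s.1 : ℝ) + s.2) := by positivity
    linarith) (hasSum_geomProd_rate hμ hl k)
  refine tendsto_div_of_tendsto_div_sq (u := fun m => (Nat.count (fun n => e n ω = k) m : ℝ))
    (fun a b hab => Nat.cast_le.2 (Nat.count_monotone _ hab)) ?_
  have h6 := h1.add h3
  rw [zero_add, mul_one] at h6
  refine h6.congr fun n => ?_
  rw [pathAvg_apply, ← add_div, ← Finset.sum_add_distrib, Nat.count_eq_card_filter_range,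
    Finset.card_eq_sum_ones, Finset.sum_filter, Nat.cast_sum]
  congr 1
  refine Finset.sum_congr rfl fun i _ => ?_
  simp only [mul_ite, mul_one, mul_zero, Finset.sum_ite_eq', Finset.mem_univ, if_true, tandemProb]
  push_cast
  ring

/-- Time averages over the jumps of the continuous-time queue. -/
theorem ae_tendsto_clock_avg (hL : HasChainLaw (tandemProb μ l) tandemNext s₀ e P)
    (hμ : 1 < μ) (hl : 1 < l) {ξ : ℕ → Ω → ℝ} (hξ : ∀ n, Measurable (ξ n))
    (hlaw : ∀ n, P.map (ξ n) = expMeasure 1) (hind : iIndepFun ξ P)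
    (heξ : IndepFun (fun ω n => e n ω) (fun ω n => ξ n ω) P) (hξ0 : ∀ᵐ ω ∂P, ∀ n, 0 ≤ ξ n ω)
    {f : ℕ × ℕ → ℝ} {C c : ℝ} (hf0 : ∀ s, 0 ≤ f s) (hf : ∀ s, |f s| ≤ C * (1 + s.1 + s.2))
    (hc : HasSum (fun s => geomProd (1 / μ) (1 / l) s * f s) c) :
    ∀ᵐ ω ∂P, Tendsto (fun m : ℕ => (∑ i ∈ Finset.range m,
      f (chainPath tandemNext s₀ (fun j => e j ω) i) * (ξ i ω
        / tandemTotal μ l (chainPath tandemNext s₀ (fun j => e j ω) i))) / m) atTop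
      (𝓝 (meanHold μ l * c)) := by
  have hμ0 : 0 ≤ μ := by linarith
  have hl0 : 0 ≤ l := by linarith
  obtain ⟨β, hβ, hβμ, hβl⟩ := exists_tandem_base hμ hl
  obtain ⟨K, hK⟩ := exists_moment_bound hL (by nlinarith : 1 < β ^ 2) hβμ hβl
  -- Only finitely many states violate `|f s| ≤ β ^ (s.1 + s.2)`; the constant absorbs them.
  obtain ⟨D, hD0, hD⟩ : ∃ D : ℝ, 0 ≤ D ∧ ∀ s, (f s / tandemTotal μ l s) ^ 2
      ≤ D * (β ^ 2) ^ (s.1 + s.2) := by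
    have hfin := finite_small_of_linear hβ hf one_pos
    obtain ⟨D, hD⟩ := (hfin.image fun s => |f s|).bddAbove
    refine ⟨(max D 1) ^ 2, by positivity, fun s => ?_⟩
    have hW : 1 ≤ β ^ (s.1 + s.2) := one_le_pow₀ hβ.le
    have h1 : |f s| ≤ max D 1 * β ^ (s.1 + s.2) := by
      by_cases h : 1 * β ^ (s.1 + s.2) < |f s|
      · have h2 : |f s| ≤ D := hD ⟨s, h, rfl⟩
        calc |f s| ≤ max D 1 * 1 := by rw [mul_one]; exact h2.trans (le_max_left _ _)
          _ ≤ _ := mul_le_mul_of_nonneg_left hW (by positivity)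
      · rw [not_lt] at h
        exact h.trans (mul_le_mul_of_nonneg_right (le_max_right _ _) (by positivity))
    have h3 : |f s / tandemTotal μ l s| ≤ max D 1 * β ^ (s.1 + s.2) := by
      rw [abs_div, abs_of_pos (tandemTotal_pos hμ0 hl0 s)]
      exact (div_le_self (abs_nonneg _) (one_le_tandemTotal hμ0 hl0 s)).trans h1
    rw [← sq_abs]
    calc _ ≤ (max D 1 * β ^ (s.1 + s.2)) ^ 2 := pow_le_pow_left₀ (abs_nonneg _) h3 2
      _ = _ := by rw [mul_pow, ← pow_mul, ← pow_mul, mul_comm 2]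
  have h := tendsto_avg_clock tandemNext s₀ hL.measurable_event hξ hlaw hind heξ
    (fun s => f s / tandemTotal μ l s) (K := D * K) (fun n => by
      refine (integral_mono (((dependsOnFirst_state tandemNext s₀
        (fun s => (f s / tandemTotal μ l s) ^ 2) n).integrable hL.measurable_event))
        (((dependsOnFirst_state tandemNext s₀
        (fun s => (β ^ 2) ^ (s.1 + s.2)) n).integrable hL.measurable_event).const_mul
          D) fun ω => hD _).trans ?_
      rw [integral_const_mul]
      exact mul_le_mul_of_nonneg_left (hK n) hD0)
  filter_upwards [h, ae_tendsto_pathAvg hL hμ hl, hξ0] with ω h1 h2 h3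
  refine tendsto_div_of_tendsto_div_sq (u := fun m => ∑ i ∈ Finset.range m,
    f (chainPath tandemNext s₀ (fun j => e j ω) i) * (ξ i ω
        / tandemTotal μ l (chainPath tandemNext s₀ (fun j => e j ω) i)))
    (monotone_nat_of_le_succ fun m => ?_) ?_
  · rw [Finset.sum_range_succ]
    exact le_add_of_nonneg_right (mul_nonneg (hf0 _)
      (div_nonneg (h3 m) (tandemTotal_pos hμ0 hl0 _).le))
  · have h6 := h1.add (h2 f C c hf hc)
    rw [zero_add] at h6
    refine h6.congr fun n => ?_
    rw [pathAvg_apply, ← add_div, ← Finset.sum_add_distrib]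
    congr 1
    refine Finset.sum_congr rfl fun i _ => by ring

end

/-! ### Little's law along a path. -/

section

theorem tendsto_nth_div {p : ℕ → Prop} [DecidablePred p] (hp : (Set.ofPred p).Infinite) {c : ℝ}
    (hc : 0 < c) (h : Tendsto (fun m : ℕ => (Nat.count p m : ℝ) / m) atTop (𝓝 c)) :
    Tendsto (fun n : ℕ => (Nat.nth p n : ℝ) / n) atTop (𝓝 c⁻¹) := by
  have h1 := (h.comp (Nat.nth_strictMono hp).tendsto_atTop).inv₀ hc.ne'
  refine h1.congr fun n => ?_
  simp only [Function.comp, Nat.count_nth_of_infinite hp, inv_div]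

theorem infinite_of_tendsto_count {p : ℕ → Prop} [DecidablePred p] {c : ℝ}
    (hc : 0 < c) (h : Tendsto (fun m : ℕ => (Nat.count p m : ℝ) / m) atTop (𝓝 c)) :
    (Set.ofPred p).Infinite := by
  intro hf
  have h1 : Tendsto (fun m : ℕ => (Nat.count p m : ℝ) / m) atTop (𝓝 0) := by
    refine squeeze_zero (fun m => by positivity) (fun m => ?_)
      (tendsto_const_div_atTop_nhds_zero_nat (hf.toFinset.card : ℝ))
    exact div_le_div_of_nonneg_right (Nat.cast_le.2 (Nat.count_le_card hf m)) (Nat.cast_nonneg _)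
  exact hc.ne (tendsto_nhds_unique h1 h)

section Little

variable {x p r : ℕ → Prop} [DecidablePred x] [DecidablePred p] [DecidablePred r]
  {τ : ℕ → ℝ} {T : ℕ → ℝ}

theorem lt_count_iff {p : ℕ → Prop} [DecidablePred p] (hp : (Set.ofPred p).Infinite) {k i : ℕ} :
    k < Nat.count p i ↔ Nat.nth p k < i := by
  rw [← not_le, ← not_le, Nat.count_le_iff_le_nth hp]

/-- Total waiting time of the first `n` customers, as an integral of truncated counts. -/
theorem sum_wait_eq (hx : (Set.ofPred x).Infinite) (hp : (Set.ofPred p).Infinite)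
    (hr : (Set.ofPred r).Infinite) (hτ : ∀ i, 0 ≤ τ i)
    (hT : ∀ n, T n = ∑ i ∈ Finset.range (n + 1), τ i)
    (hle : ∀ i, min (Nat.count p i) (Nat.count r i) ≤ Nat.count x i) (n : ℕ) :
    ∑ k ∈ Finset.range n, (max (T (Nat.nth p k)) (T (Nat.nth r k)) - T (Nat.nth x k))
      = ∑ i ∈ Finset.range (max (Nat.nth p n) (Nat.nth r n)), τ i *
        ((min n (Nat.count x i) : ℕ) - (min n (min (Nat.count p i) (Nat.count r i)) : ℕ)) := by
  have hmono : Monotone T := monotone_nat_of_le_succ fun m => by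
    rw [hT (m + 1), Finset.sum_range_succ, ← hT]
    linarith [hτ (m + 1)]
  set F : ℕ → ℕ := fun k => max (Nat.nth p k) (Nat.nth r k) with hF
  have hFlt : ∀ k i, k < min (Nat.count p i) (Nat.count r i) ↔ F k < i := by
    intro k i
    rw [lt_min_iff, lt_count_iff hp, lt_count_iff hr, hF]
    exact max_lt_iff.symm
  have hxF : ∀ k, Nat.nth x k ≤ F k := by
    intro k
    have h1 := (hFlt k (F k + 1)).2 (Nat.lt_succ_self _)
    exact Nat.lt_succ_iff.1 ((lt_count_iff hx).1 (h1.trans_le (hle _)))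
  have hFn : ∀ k < n, F k < F n := fun k hk =>
    max_lt_max (Nat.nth_strictMono hp hk) (Nat.nth_strictMono hr hk)
  have hTsum : ∀ m < F n, T m = ∑ i ∈ Finset.range (F n), if i ≤ m then τ i else 0 := by
    intro m hm
    rw [hT, ← Finset.sum_filter]
    refine Finset.sum_congr ?_ fun _ _ => rfl
    ext i
    simp only [Finset.mem_range, Finset.mem_filter]
    omega
  -- After exchanging the sums, the coefficient of `τ i` is the number of `k < n` whose event `G k`
  -- is not among the first `i` transitions.
  have hcount : ∀ (G : ℕ → ℕ) (c i : ℕ), (∀ k, k < c ↔ G k < i) →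
      ∑ k ∈ Finset.range n, (if i ≤ G k then τ i else 0) = τ i * (n - (min n c : ℕ)) := by
    intro G c i h
    have h1 : ∀ k, (if i ≤ G k then τ i else 0) = τ i - (if k < c then τ i else 0) := by
      intro k
      by_cases hk : k < c
      · rw [if_neg (not_le.2 ((h k).1 hk)), if_pos hk, sub_self]
      · rw [if_pos (not_lt.1 fun h' => hk ((h k).2 h')), if_neg hk, sub_zero]
    simp_rw [h1]
    rw [Finset.sum_sub_distrib, Finset.sum_const, Finset.card_range, ← Finset.sum_filter,
      Finset.sum_const]
    have h2 : (Finset.range n).filter (fun k => k < c) = Finset.range (min n c) := by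
      ext k; simp
    rw [h2, Finset.card_range, nsmul_eq_mul, nsmul_eq_mul]
    ring
  have h1 : ∀ k ∈ Finset.range n, max (T (Nat.nth p k)) (T (Nat.nth r k)) - T (Nat.nth x k)
      = (∑ i ∈ Finset.range (F n), if i ≤ F k then τ i else 0)
        - ∑ i ∈ Finset.range (F n), if i ≤ Nat.nth x k then τ i else 0 := by
    intro k hk
    have hk' := hFn k (Finset.mem_range.1 hk)
    rw [← hmono.map_max, ← hTsum _ hk', ← hTsum _ ((hxF k).trans_lt hk')]
  rw [Finset.sum_congr rfl h1, Finset.sum_sub_distrib, Finset.sum_comm,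
    Finset.sum_comm (s := Finset.range n), ← Finset.sum_sub_distrib]
  refine Finset.sum_congr rfl fun i _ => ?_
  rw [hcount F _ i fun k => hFlt k i, hcount (Nat.nth x) _ i fun k => lt_count_iff hx]
  ring

/-- Little's law along a path. -/
theorem tendsto_avg_wait {c w : ℝ} (hc : 0 < c)
    (hcx : Tendsto (fun m : ℕ => (Nat.count x m : ℝ) / m) atTop (𝓝 c))
    (hcp : Tendsto (fun m : ℕ => (Nat.count p m : ℝ) / m) atTop (𝓝 c))
    (hcr : Tendsto (fun m : ℕ => (Nat.count r m : ℝ) / m) atTop (𝓝 c))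
    (hτ : ∀ i, 0 ≤ τ i) (hT : ∀ n, T n = ∑ i ∈ Finset.range (n + 1), τ i)
    (hle : ∀ i, min (Nat.count p i) (Nat.count r i) ≤ Nat.count x i) {N : ℕ → ℝ}
    (hN : ∀ i, N i = (Nat.count x i : ℝ) - (min (Nat.count p i) (Nat.count r i) : ℕ))
    (hG : Tendsto (fun m : ℕ => (∑ i ∈ Finset.range m, N i * τ i) / m) atTop (𝓝 (c * w))) :
    Tendsto (fun n : ℕ => (∑ k ∈ Finset.range n,
      (max (T (Nat.nth p k)) (T (Nat.nth r k)) - T (Nat.nth x k))) / n) atTop (𝓝 w) := by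
  have hx := infinite_of_tendsto_count hc hcx
  have hp := infinite_of_tendsto_count hc hcp
  have hr := infinite_of_tendsto_count hc hcr
  have lx := tendsto_nth_div hx hc hcx
  have lF : Tendsto (fun n : ℕ => ((max (Nat.nth p n) (Nat.nth r n) : ℕ) : ℝ) / n) atTop
      (𝓝 c⁻¹) := by
    have := (tendsto_nth_div hp hc hcp).max (tendsto_nth_div hr hc hcr)
    rw [max_self] at this
    refine this.congr fun n => ?_
    rw [Nat.cast_max, max_div_div_right (Nat.cast_nonneg n)]
  have hN0 : ∀ i, 0 ≤ N i := fun i => by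
    rw [hN, sub_nonneg]; exact Nat.cast_le.2 (hle i)
  have hlim : ∀ u : ℕ → ℕ, Tendsto u atTop atTop →
      Tendsto (fun n : ℕ => (u n : ℝ) / n) atTop (𝓝 c⁻¹) →
      Tendsto (fun n : ℕ => (∑ i ∈ Finset.range (u n), N i * τ i) / n) atTop (𝓝 w) := by
    intro u hu hu'
    have := (hG.comp hu).mul hu'
    rw [mul_comm c w, mul_assoc, mul_inv_cancel₀ hc.ne', mul_one] at this
    refine this.congr' ?_
    filter_upwards [hu.eventually (eventually_gt_atTop 0)] with n hn
    have hn' : (u n : ℝ) ≠ 0 := by exact_mod_cast hn.ne'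
    simp only [Function.comp]
    field_simp
  have hmaxinf : Tendsto (fun n => max (Nat.nth p n) (Nat.nth r n)) atTop atTop :=
    tendsto_atTop_mono (fun n => le_max_left _ _) (Nat.nth_strictMono hp).tendsto_atTop
  -- Before the arrival of customer `n` only customers below `n` have come, so truncation has no
  -- effect and the integral of `N` is a lower bound. Up to the fetch time of customer `n`,
  -- truncation only lowers the count, which gives the upper bound. Both indices grow like `n / c`.
  refine tendsto_of_tendsto_of_tendsto_of_le_of_le
    (hlim _ (Nat.nth_strictMono hx).tendsto_atTop lx) (hlim _ hmaxinf lF) (fun n => ?_) fun n => ?_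
  · refine div_le_div_of_nonneg_right ?_ (Nat.cast_nonneg n)
    rw [sum_wait_eq hx hp hr hτ hT hle]
    have hxF : Nat.nth x n ≤ max (Nat.nth p n) (Nat.nth r n) := by
      have h1 : n < min (Nat.count p (max (Nat.nth p n) (Nat.nth r n) + 1))
          (Nat.count r (max (Nat.nth p n) (Nat.nth r n) + 1)) := by
        rw [lt_min_iff, lt_count_iff hp, lt_count_iff hr]
        omega
      exact Nat.lt_succ_iff.1 ((lt_count_iff hx).1 (h1.trans_le (hle _)))
    refine le_trans (Finset.sum_le_sum fun i hi => ?_) (Finset.sum_le_sum_of_subset_of_nonneg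
      (Finset.range_mono hxF) fun i _ _ => ?_)
    · have h2 : Nat.count x i ≤ n :=
        (Nat.count_le_iff_le_nth hx).2 (Finset.mem_range.1 hi).le
      rw [min_eq_right h2, min_eq_right ((hle i).trans h2), hN, mul_comm]
    · refine mul_nonneg (hτ i) (sub_nonneg.2 (Nat.cast_le.2 ?_))
      exact min_le_min_left n (hle i)
  · refine div_le_div_of_nonneg_right ?_ (Nat.cast_nonneg n)
    rw [sum_wait_eq hx hp hr hτ hT hle]
    refine Finset.sum_le_sum fun i _ => ?_
    rw [mul_comm (N i)]
    refine mul_le_mul_of_nonneg_left ?_ (hτ i)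
    rw [hN, ← Nat.cast_sub (hle i), ← Nat.cast_sub (min_le_min_left n (hle i))]
    exact Nat.cast_le.2 (by omega)

end Little

/-! ### From the dispatch system to the tandem queue. -/

section Transfer

variable {μ : ℝ} {lam : ℕ → ℝ} {d : ℕ}

/-- The two-dimensional state corresponds to the tandem queue with `d` extra rider slots. -/
def Matches (d : ℕ) (s : State) (t : ℕ × ℕ) : Prop := s.1 = t.1 ∧ s.2 + d = t.2

theorem Matches.rate_eq {s : State} {t : ℕ × ℕ} (h : Matches d s t) (k : Event) :
    rate μ lam d ⊤ s k = tandemRate μ (lam 0) t k := by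
  obtain ⟨h1, h2⟩ := h
  cases k
  · rfl
  · simp only [rate, tandemRate, h1]
  · have : -(d : ℤ) < s.2 ↔ 0 < t.2 := by omega
    simp only [rate, tandemRate, this]
    rfl

theorem Matches.totalRate_eq {s : State} {t : ℕ × ℕ} (h : Matches d s t) :
    totalRate μ lam d ⊤ s = tandemTotal μ (lam 0) t := by
  rw [totalRate, tandemTotal, sum_event, h.rate_eq, h.rate_eq, h.rate_eq, add_assoc]

theorem Matches.step {s : State} {t : ℕ × ℕ} (h : Matches d s t) {l : ℝ} {k : Event}
    (hk : 0 < tandemRate μ l t k) : Matches d (step s k) (tandemNext t k) := by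
  obtain ⟨h1, h2⟩ := h
  cases k
  · exact ⟨by simp [MealDelivery.step, tandemNext, h1], h2⟩
  · refine ⟨by simp [MealDelivery.step, tandemNext, h1], ?_⟩
    simp only [MealDelivery.step, tandemNext]; push_cast; omega
  · have h3 : 0 < t.2 := by
      by_contra h'
      simp [tandemRate, h'] at hk
    refine ⟨by simp [MealDelivery.step, tandemNext, h1], ?_⟩
    simp only [MealDelivery.step, tandemNext]
    omega

theorem matches_path {l : ℝ} {a : ℕ → Event} {n : ℕ}
    (h : ∀ i < n, 0 < tandemRate μ l (chainPath tandemNext (0, d) a i) (a i)) :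
    Matches d (stateAfter a n) (chainPath tandemNext (0, d) a n) := by
  induction n with
  | zero => exact ⟨rfl, by simp [stateAfter, chainPath]⟩
  | succ n ih => exact (ih fun i hi => h i (by omega)).step (h n (by omega))

/-- Conservation of flow through the two stations; positivity of the rates ensures that truncated
subtraction never takes effect. -/
theorem count_path {l : ℝ} {a : ℕ → Event}
    (h : ∀ i, 0 < tandemRate μ l (chainPath tandemNext (0, d) a i) (a i)) (n : ℕ) :
    Nat.count (fun i => a i = Event.order) n
        = Nat.count (fun i => a i = Event.prepared) n + (chainPath tandemNext (0, d) a n).1 ∧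
      Nat.count (fun i => a i = Event.prepared) n + d
        = Nat.count (fun i => a i = Event.rider) n + (chainPath tandemNext (0, d) a n).2 := by
  induction n with
  | zero => simp [chainPath]
  | succ n ih =>
    have hn := h n
    simp only [Nat.count_succ, chainPath]
    revert ih hn
    generalize chainPath tandemNext (0, d) a n = t
    generalize a n = k
    intro ih hn
    cases k
    · simp only [tandemNext, reduceCtorEq, if_true, if_false]; omega
    · have h3 : 0 < t.1 := by
        by_contra h'
        simp [tandemRate, h'] at hn
      simp only [tandemNext, reduceCtorEq, if_true, if_false]; omega
    · have h3 : 0 < t.2 := by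
        by_contra h'
        simp [tandemRate, h'] at hn
      simp only [tandemNext, reduceCtorEq, if_true, if_false]; omega

variable {Ω : Type*} [MeasurableSpace Ω] {P : Measure Ω}
  {e : ℕ → Ω → Event} {ξ : ℕ → Ω → ℝ}

/-- The two state recursions can disagree only after a transition of rate zero, and such histories
have probability zero in both descriptions. -/
theorem IsDispatchSystem.hasChainLaw (hμ : 0 ≤ μ) (hl : 0 ≤ lam 0)
    (hsys : IsDispatchSystem μ lam d ⊤ e ξ P) :
    HasChainLaw (tandemProb μ (lam 0)) tandemNext (0, d) e P where
  measurable_event := hsys.measurable_event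
  event_law n a := by
    rw [hsys.event_law]
    by_cases h : ∀ i < n, 0 < tandemRate μ (lam 0) (chainPath tandemNext (0, d) a i) (a i)
    · refine Finset.prod_congr rfl fun i hi => ?_
      have hm := matches_path fun j (hj : j < i) => h j (hj.trans (Finset.mem_range.1 hi))
      rw [hm.rate_eq, hm.totalRate_eq, tandemProb]
    -- Up to the first impossible transition the states still match, so both products contain a zero
    -- factor at that index.
    · push Not at h
      classical
      have hi := Nat.find_spec h
      set i := Nat.find h with hidef
      have hlt : ∀ j < i, 0 < tandemRate μ (lam 0) (chainPath tandemNext (0, d) a j) (a j) := by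
        intro j hj
        by_contra h'
        exact Nat.find_min h hj ⟨hj.trans hi.1, not_lt.1 h'⟩
      have hm := matches_path hlt
      have h0 : tandemRate μ (lam 0) (chainPath tandemNext (0, d) a i) (a i) = 0 :=
        le_antisymm hi.2 (tandemRate_nonneg hμ hl _ _)
      rw [Finset.prod_eq_zero (Finset.mem_range.2 hi.1),
        Finset.prod_eq_zero (Finset.mem_range.2 hi.1)]
      · rw [tandemProb, h0]; simp
      · rw [hm.rate_eq, h0]; simp

/-- The indicator of a transition of rate zero has conditional mean zero. This supplies the
hypothesis of `matches_path` and `count_path` on almost every path. -/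
theorem HasChainLaw.ae_rate_pos [IsProbabilityMeasure P] {l : ℝ} {s₀ : ℕ × ℕ} (hμ : 0 ≤ μ)
    (hl : 0 ≤ l) (hL : HasChainLaw (tandemProb μ l) tandemNext s₀ e P) :
    ∀ᵐ ω ∂P, ∀ i, 0 < tandemRate μ l (chainPath tandemNext s₀ (fun j => e j ω) i) (e i ω) := by
  rw [ae_all_iff]
  intro i
  set h : ℕ × ℕ → Event → ℝ := fun s k => if 0 < tandemRate μ l s k then 0 else 1 with hh
  have h1 := hL.integral_mul_step (tandemProb_nonneg hμ hl) (n := i) (g := fun _ => 1)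
    (fun _ _ _ => rfl) h
  have h2 : ∀ s, ∑ k, tandemProb μ l s k * h s k = 0 := by
    intro s
    refine Finset.sum_eq_zero fun k _ => ?_
    simp only [hh]
    split_ifs with hk
    · simp
    · rw [tandemProb, le_antisymm (not_lt.1 hk) (tandemRate_nonneg hμ hl s k)]; simp
  simp only [one_mul, h2, integral_zero] at h1
  have hint : Integrable (fun ω => h (chainPath tandemNext s₀ (fun j => e j ω) i) (e i ω)) P :=
    (dependsOnFirst_step tandemNext s₀ h i).integrable hL.measurable_event
  rw [integral_eq_zero_iff_of_nonneg (fun ω => by simp only [hh]; positivity) hint] at h1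
  filter_upwards [h1] with ω hω
  by_contra hneg
  simp [hh, hneg] at hω

end Transfer

/-! ### The numerical inequality. -/

/-- Let `u = d (1 - x)`. If `u ≥ 2` the claim is immediate. Otherwise Bernoulli with exponent `d /
2` gives `x ^ d ≥ (1 - u / 2) ^ 2`, and the expression is at least `(1 - x) u + x / 2 + x (u - 1) ^
2 / 2 ≥ x / 2`. -/
theorem one_twelfth_le_wait {x : ℝ} (hx0 : 0.3 ≤ x) (hx1 : x < 1) {d : ℕ} (hd : 3 ≤ d) :
    1 / 12 ≤ d * (1 - x) - x + 2 * x ^ (d + 1) := by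
  have hd' : (3 : ℝ) ≤ d := by exact_mod_cast hd
  have hx : 0 ≤ x := by norm_num at hx0; linarith
  norm_num at hx0
  set u := (d : ℝ) * (1 - x) with hu
  have hu0 : 0 ≤ u := mul_nonneg (by linarith) (by linarith)
  have hpow : 0 ≤ x ^ (d + 1) := pow_nonneg hx _
  rcases le_total 2 u with h2 | h2
  · linarith
  · have hb := one_add_mul_self_le_rpow_one_add (s := x - 1) (by linarith) (p := (d : ℝ) / 2)
      (by linarith)
    have h1 : 1 + (d : ℝ) / 2 * (x - 1) = 1 - u / 2 := by rw [hu]; ring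
    rw [h1, add_sub_cancel] at hb
    have h3 : (1 - u / 2) ^ 2 ≤ x ^ d := by
      have h4 := pow_le_pow_left₀ (by linarith) hb 2
      rwa [← Real.rpow_natCast (x ^ ((d : ℝ) / 2)), ← Real.rpow_mul hx, Nat.cast_ofNat,
        div_mul_cancel₀ _ (two_ne_zero), Real.rpow_natCast] at h4
    have h5 := mul_le_mul_of_nonneg_left h3 hx
    have h6 : 0 ≤ (1 - x) * u := mul_nonneg (by linarith) hu0
    have h7 : 0 ≤ x * (u - 1) ^ 2 := mul_nonneg hx (sq_nonneg _)
    rw [pow_succ]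
    nlinarith

/-- Lower bound for the waiting time of riders in a feasible system. -/
theorem rider_wait_lower_bound {ρ x T : ℝ} {d : ℕ} (hρ : 0.3 ≤ ρ) (hρx : ρ ≤ x) (hx1 : x < 1)
    (hT : T ≤ ρ ^ 4 / (1 - ρ)) (hfeas : x ^ (d + 1) / (1 - x) ≤ T) :
    Real.log (4 / 3) / (4 * (1 - ρ)) - T ≤ d - x / (1 - x) + x ^ (d + 1) / (1 - x) := by
  have hρ0 : 0 < ρ := by norm_num at hρ; linarith
  have hx0 : 0 < x := hρ0.trans_le hρx
  have h1x : 0 < 1 - x := by linarith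
  have h1ρ : 0 < 1 - ρ := by linarith
  -- Since `t ^ 4 / (1 - t)` increases with `t`, feasibility gives `x ^ (d + 1) ≤ x ^ 4`.
  have hd : 3 ≤ d := by
    by_contra hd
    have h1 : x ^ (d + 1) / (1 - x) ≤ x ^ 4 / (1 - x) := by
      refine (hfeas.trans hT).trans ?_
      exact div_le_div₀ (by positivity) (pow_le_pow_left₀ hρ0.le hρx 4) h1x (by linarith)
    rw [div_le_div_iff_of_pos_right h1x] at h1
    have h2 : x ^ 4 < x ^ (d + 1) := pow_lt_pow_right_of_lt_one₀ hx0 hx1 (by omega)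
    linarith
  have h1 := one_twelfth_le_wait (hρ.trans hρx) hx1 hd
  have hlog : Real.log (4 / 3) ≤ 1 / 3 := by
    have := Real.log_le_sub_one_of_pos (x := 4 / 3) (by norm_num)
    linarith
  have h2 : Real.log (4 / 3) / (4 * (1 - ρ)) ≤ (1 / 12) / (1 - x) := by
    have h3 : Real.log (4 / 3) / (4 * (1 - ρ)) = (Real.log (4 / 3) / 4) / (1 - ρ) := by
      rw [div_div]
    rw [h3]
    exact div_le_div₀ (by norm_num) (by linarith) h1x (by linarith)
  have h3 : (1 / 12) / (1 - x) ≤ (d * (1 - x) - x + 2 * x ^ (d + 1)) / (1 - x) :=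
    div_le_div_of_nonneg_right h1 h1x.le
  -- The doubled power is the riders' own term plus a second copy, which feasibility bounds by `T`.
  have h4 : (d * (1 - x) - x + 2 * x ^ (d + 1)) / (1 - x)
      = d - x / (1 - x) + x ^ (d + 1) / (1 - x) + x ^ (d + 1) / (1 - x) := by
    field_simp; ring
  linarith

/-! ### The two mean waiting times and the conclusion. -/

section Mean

variable {μ : ℝ} {lam : ℕ → ℝ} {d : ℕ} {Ω : Type*} [MeasurableSpace Ω] {P : Measure Ω}
  {e : ℕ → Ω → Event} {ξ : ℕ → Ω → ℝ}

theorem IsDispatchSystem.ae_clock_nonneg (hsys : IsDispatchSystem μ lam d ⊤ e ξ P) :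
    ∀ᵐ ω ∂P, ∀ n, 0 ≤ ξ n ω := by
  rw [ae_all_iff]
  intro n
  have := ae_nonneg_expMeasure
  rw [← hsys.clock_law n] at this
  exact ae_of_ae_map (hsys.measurable_clock n).aemeasurable this

/-- Mean waiting times in a dispatch system, for the customers whose arrivals are transitions of
kind `k` and whose number in the system is `N` as a function of the state. -/
theorem IsDispatchSystem.isMeanWait [IsProbabilityMeasure P] (hμ : 1 < μ) (hl : 1 < lam 0)
    (hsys : IsDispatchSystem μ lam d ⊤ e ξ P) (k : Event) {N : ℕ × ℕ → ℕ}
    {C w : ℝ} (hC : ∀ s, |(N s : ℝ)| ≤ C * (1 + s.1 + s.2))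
    (hw : HasSum (fun s => geomProd (1 / μ) (1 / lam 0) s * (N s : ℝ)) w)
    (hN : ∀ cₒ cₚ cᵣ : ℕ, ∀ s : ℕ × ℕ, cₒ = cₚ + s.1 → cₚ + d = cᵣ + s.2 →
      (match k with | Event.order => cₒ | Event.prepared => cₚ | Event.rider => cᵣ)
        = min cₚ cᵣ + N s) :
    IsMeanWait (fun n ω => fetchTime μ lam d ⊤ e ξ n ω - eventTime μ lam d ⊤ e ξ k n ω) P w := by
  have hL := hsys.hasChainLaw (by linarith) (by linarith)
  filter_upwards [ae_tendsto_count hL hμ hl k, ae_tendsto_count hL hμ hl Event.prepared,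
    ae_tendsto_count hL hμ hl Event.rider, hL.ae_rate_pos (by linarith) (by linarith),
    hsys.ae_clock_nonneg,
    ae_tendsto_clock_avg hL hμ hl hsys.measurable_clock hsys.clock_law hsys.clock_indep
      hsys.event_clock_indep hsys.ae_clock_nonneg (f := fun s => (N s : ℝ))
      (fun s => Nat.cast_nonneg _) hC hw] with ω hk hp hr hpos hξ hG
  -- The minimum of the two counts is the number of orders fetched so far, so `N` is what remains of
  -- the arrivals of kind `k`.
  have hcount : ∀ i, Nat.count (fun j => e j ω = k) i
      = min (Nat.count (fun j => e j ω = Event.prepared) i)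
        (Nat.count (fun j => e j ω = Event.rider) i)
        + N (chainPath tandemNext (0, d) (fun j => e j ω) i) := by
    intro i
    obtain ⟨h1, h2⟩ := count_path hpos i
    have := hN _ _ _ _ h1 h2
    cases k <;> exact this
  refine tendsto_avg_wait (meanHold_pos hμ hl) hk hp hr (T := fun n => jumpTime μ lam d ⊤ e ξ n ω)
    (fun i => div_nonneg (hξ i) (tandemTotal_pos (by linarith) (by linarith)
      (chainPath tandemNext (0, d) (fun j => e j ω) i)).le) (fun n => ?_)
    (fun i => by rw [hcount]; exact Nat.le_add_right _ _)
    (N := fun i => (N (chainPath tandemNext (0, d) (fun j => e j ω) i) : ℝ)) (fun i => ?_) hG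
  · rw [jumpTime]
    refine Finset.sum_congr rfl fun i _ => ?_
    rw [(matches_path (d := d) (a := fun j => e j ω) fun j _ => hpos j).totalRate_eq]
  · rw [hcount, Nat.cast_add]; ring

/-- The orders present are the `a` unprepared ones and the excess `(r - d)⁺`; the two summands are
their stationary means. -/
theorem IsDispatchSystem.isMeanWait_order [IsProbabilityMeasure P] (hμ : 1 < μ) (hl : 1 < lam 0)
    (hsys : IsDispatchSystem μ lam d ⊤ e ξ P) :
    IsMeanWait (orderWait μ lam d ⊤ e ξ) P
      (1 / (μ - 1) + (1 / lam 0) ^ (d + 1) / (1 - 1 / lam 0)) := by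
  have hx0 : 0 < 1 / μ := by positivity
  have hx1 : 1 / μ < 1 := by rw [div_lt_one (by linarith)]; exact hμ
  have hy0 : 0 < 1 / lam 0 := by positivity
  have hy1 : 1 / lam 0 < 1 := by rw [div_lt_one (by linarith)]; exact hl
  refine hsys.isMeanWait hμ hl Event.order (N := fun s => s.1 + (s.2 - d)) (C := 1) ?_ ?_ ?_
  · intro s
    rw [abs_of_nonneg (Nat.cast_nonneg _), one_mul]
    have : s.1 + (s.2 - d) ≤ 1 + s.1 + s.2 := by omega
    exact_mod_cast this
  · have h1 := hasSum_geomProd_mul (fun n => Nat.cast_nonneg _) (fun _ => zero_le_one) hx0.le hx1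
      hy0.le hy1 (hasSum_geom_excess hx0.le hx1 0) (hasSum_geom_one hy0.le hy1)
    have h2 := hasSum_geomProd_mul (fun _ => zero_le_one) (fun n => Nat.cast_nonneg _) hx0.le hx1
      hy0.le hy1 (hasSum_geom_one hx0.le hx1) (hasSum_geom_excess hy0.le hy1 d)
    convert! h1.add h2 using 1
    · funext s
      push_cast
      simp only [Nat.sub_zero]; ring
    · have : μ - 1 ≠ 0 := by linarith
      have h3 : 1 - 1 / μ ≠ 0 := by linarith
      have h4 : (1 / μ) / (1 - 1 / μ) = 1 / (μ - 1) := by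
        rw [div_div, mul_sub, mul_one, mul_one_div_cancel (by linarith)]
      rw [zero_add, pow_one, h4]; ring
  · intro a b c s h1 h2
    simp only
    omega

/-- The waiting riders number `(d - r)⁺`, the shortfall of the second queue below `d`. -/
theorem IsDispatchSystem.isMeanWait_rider [IsProbabilityMeasure P] (hμ : 1 < μ) (hl : 1 < lam 0)
    (hsys : IsDispatchSystem μ lam d ⊤ e ξ P) :
    IsMeanWait (riderWait μ lam d ⊤ e ξ) P
      (d - (1 / lam 0) / (1 - 1 / lam 0) + (1 / lam 0) ^ (d + 1) / (1 - 1 / lam 0)) := by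
  have hx0 : 0 < 1 / μ := by positivity
  have hx1 : 1 / μ < 1 := by rw [div_lt_one (by linarith)]; exact hμ
  have hy0 : 0 < 1 / lam 0 := by positivity
  have hy1 : 1 / lam 0 < 1 := by rw [div_lt_one (by linarith)]; exact hl
  refine hsys.isMeanWait hμ hl Event.rider (N := fun s => d - s.2) (C := d) ?_ ?_ ?_
  · intro s
    rw [abs_of_nonneg (Nat.cast_nonneg _)]
    have h1 : d - s.2 ≤ d * (1 + s.1 + s.2) := (Nat.sub_le _ _).trans
      (Nat.le_mul_of_pos_right _ (by omega))
    exact_mod_cast h1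
  · have h2 := hasSum_geomProd_mul (fun _ => zero_le_one) (fun n => Nat.cast_nonneg _) hx0.le hx1
      hy0.le hy1 (hasSum_geom_one hx0.le hx1) (hasSum_geom_shortfall hy0.le hy1 d)
    simpa using h2
  · intro a b c s h1 h2
    simp only
    omega

end Mean

end

end MealDelivery

end

theorem mainTheorem3 {Ω : Type*} [MeasurableSpace Ω] (P : Measure Ω) [IsProbabilityMeasure P]
    (μ Λ Tstar : ℝ) (hμ : 1 < μ) (hΛ : 1 < Λ)
    (hρ : 0.3 ≤ 1 / Λ) (hT : Tstar ≤ (1 / Λ) ^ 4 / (1 - 1 / Λ))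
    (lam : ℕ → ℝ) (d : ℕ) (hlam : 1 < lam 0) (hlamΛ : lam 0 ≤ Λ)
    (e : ℕ → Ω → MealDelivery.Event) (ξ : ℕ → Ω → ℝ)
    (hsys : MealDelivery.IsDispatchSystem μ lam d ⊤ e ξ P) :
    ∃ To Tr : ℝ,
      MealDelivery.IsMeanWait (MealDelivery.orderWait μ lam d ⊤ e ξ) P To ∧
      MealDelivery.IsMeanWait (MealDelivery.riderWait μ lam d ⊤ e ξ) P Tr ∧
      (To ≤ 1 / (μ - 1) + Tstar →
        Real.log (4 / 3) / (4 * (1 - 1 / Λ)) - Tstar ≤ Tr ∧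
        0 < Real.log (4 / 3) / (8 * (1 - 1 / Λ)) ∧
        Real.log (4 / 3) / (8 * (1 - 1 / Λ)) ≤ max Tstar Tr) := by
  have hΛ0 : 0 < Λ := by linarith
  have hρ1 : 1 / Λ < 1 := by rw [div_lt_one hΛ0]; exact hΛ
  have hx1 : 1 / lam 0 < 1 := by rw [div_lt_one (by linarith)]; exact hlam
  have hρx : 1 / Λ ≤ 1 / lam 0 := one_div_le_one_div_of_le (by linarith) hlamΛ
  refine ⟨_, _, hsys.isMeanWait_order hμ hlam, hsys.isMeanWait_rider hμ hlam, fun hfeas => ?_⟩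
  have hmain := MealDelivery.rider_wait_lower_bound hρ hρx hx1 hT
    ((add_le_add_iff_left _).1 hfeas)
  have hlog : 0 < Real.log (4 / 3) := Real.log_pos (by norm_num)
  refine ⟨hmain, div_pos hlog (by linarith), ?_⟩
  set Tr := (d : ℝ) - 1 / lam 0 / (1 - 1 / lam 0) + (1 / lam 0) ^ (d + 1) / (1 - 1 / lam 0)
  have hhalf : Real.log (4 / 3) / (8 * (1 - 1 / Λ))
      = Real.log (4 / 3) / (4 * (1 - 1 / Λ)) / 2 := by
    rw [div_div]; ring_nf
  rw [hhalf]
  -- The maximum is at least half of `Tstar + Tr`, which `hmain` bounds below.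
  linarith [le_max_left Tstar Tr, le_max_right Tstar Tr]
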